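/- **Setting.** A system qubit $\mathsf S$ and an environment qubit $\mathsf E$ evolve under $H(\omega)=\frac{\omega}{2}\sigma_Z^{\mathsf S}+\mathbb 1+g\,\mathrm{SWAP}$, with the environment initially in $|0\rangle$; $\omega$ is the unknown frequency. Put $\Omega=\sqrt{g^2+\omega^2/4}$ and $\epsilon^\ast=\pi/(2\Omega T)$. A free-evolution (FE) strategy consists of a finite-dimensional ancilla, a probe state (density matrix) of system and ancilla, a finite-outcome POVM on system and ancilla, and an arbitrary real-valued estimator $\hat\omega$ of the $\nu\ge1$ outcomes. In each of $\nu$ runs the probe evolves freely, without control, and is measured. If the set duration is $T$, the actual duration is $T(1+u)$, where $u$ has an unknown distribution $f$. The outcomes are $\nu$ i.i.d. samples of the outcome distribution averaged over $u\sim f$. Let $\mathcal F^Q_\omega[\xi,\mathrm{FE}]$ be the quantum Fisher information (via the symmetric logarithmic derivative) about $\omega$ of the system–ancilla state after actual duration $T(1+\xi)$ (that is, for $f=\delta(u-\xi)$), maximized over ancillas and probe states. Without environment ($g=0$) and for $\xi=0$ it equals $T^2$; the Heisenberg limit is $1/(\nu T^2)$. Let $\mathcal R(f,s)=\mathrm E[(\hat\omega-\omega)^2]$,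 and let $b_{f}(\omega)=\mathrm E(\hat\omega)-\omega$ be the bias. Let $\mathcal N$ be either the set of delta distributions $\delta(u-\xi)$, $|\xi|\le\epsilon$, or the set of all probability distributions on $[-\epsilon,\epsilon]$. As in local estimation around the reference frequency $0$, for $0\le\kappa\le1$ only strategies are admitted whose bias is linear, $b_f(\omega)=m\,\omega$ with $m=\partial_\omega b_f(\omega)$, up to a remainder: $|b_f(\omega)-\omega\,\partial_\omega b_f(\omega)|\le\kappa|\omega|$ for every $f\in\mathcal N$. Put $\mathcal L_{\mathrm{FE}}=\inf_s\sup_{f\in\mathcal N}\mathcal R(f,s)$ over these strategies. **Statement.** Here $\omega,\xi$ are real, $T>0$, $\epsilon\ge0$. 1. (Bias-optimized biased Cramér–Rao bound.) For $g\ge 0$ and $\omega\ne0$, $$\mathcal L_{\mathrm{FE}}\ \ge\ \sup_{|\xi|\le\epsilon}\frac{(1-\kappa)^2}{\omega^{-2}+\nu\,\mathcal F^Q_\omega[\xi,\mathrm{FE}]}.$$ There is an absolute constant $C>0$ such that, for all $g>0$ and $|\omega|\le g$, claims 2–4 hold. 2. (QFI bound.) With $t=T(1+\xi)$, $$\mathcal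 F^Q_\omega[\xi,\mathrm{FE}]\le\frac{2\,[g t\cos(\Omega t)+\sin(\Omega t)]^2}{g^2(\cos(2\Omega t)+3)}+C\,\frac{\omega^2t^2}{g^2}.$$ If moreover $|\xi|\le1$ and $T$ is so large that $T\ge g/\omega^2$ (with $\omega\neq0$), then $$\mathcal F^Q_\omega[\xi,\mathrm{FE}]\le\frac{2T^2(1+\xi)^2\cos^2[T\Omega(1+\xi)]}{\cos[2T(1+\xi)\Omega]+3}+C\,\frac{\omega^2T^2}{g^2}.$$ 3. If $\omega\ne0$, $gT\ge1$ and $\epsilon\ge\epsilon^\ast$, then $$\mathcal L_{\mathrm{FE}}\ge(1-\kappa)^2\left[\Bigl(1-\frac{C}{gT}\Bigr)\frac{g^2\omega^2}{\nu\omega^4T^2+g^2}-C\,\frac{\nu\omega^8T^2}{(g^2+\nu T^2\omega^4)^2}\right].$$ 4. If $\omega\ne0$, $gT\ge1$ and $\epsilon<\epsilon^\ast$, then $$\mathcal L_{\mathrm{FE}}\ge(1-\kappa)^2\left[\Bigl(1-\frac{C}{gT}\Bigr)\frac{1}{\nu T^2\left[\frac{\omega^2}{g^2}+\cos^2(\epsilon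 T\Omega)\right]+\omega^{-2}}-C\,\frac{\omega^4}{\nu T^2\,[g^2\cos^2(T\Omega\epsilon)+\omega^2]^2}\right].$$ 5. For fixed $g>0$ and $\omega\ne0$, the ratio of $g^2\omega^2/(\nu\omega^4T^2+g^2)$ to the Heisenberg limit $1/(\nu T^2)$ tends to $g^2/\omega^2$ as $\nu,T\to\infty$. -/

import Mathlib

open Matrix MeasureTheory Filter Topology
open scoped Kronecker ENNReal ComplexOrder

noncomputable section

namespace TDI

/-- A density matrix: positive semidefinite of trace one. -/
structure DensityMatrix (n : Type) [Fintype n] where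
  mat : Matrix n n ℂ
  posSemidef : mat.PosSemidef
  trace_eq_one : mat.trace = 1

/-- The Pauli matrix `σ_Z`. -/
def pauliZ : Matrix (Fin 2) (Fin 2) ℂ := !![1, 0; 0, -1]

/-- The SWAP gate on system ⊗ environment, `|s e⟩ ↦ |e s⟩`. -/
def swapGate : Matrix (Fin 2 × Fin 2) (Fin 2 × Fin 2) ℂ :=
  Matrix.of fun p q => if p.1 = q.2 ∧ p.2 = q.1 then 1 else 0

/-- The joint Hamiltonian `H(ω) = H_S(ω) + H_E + H_SE` on system ⊗ environment, with
`H_S = (ω/2) σ_Z`, `H_E` the identity, `H_SE = g SWAP`. -/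
def hamiltonian (g ω : ℝ) : Matrix (Fin 2 × Fin 2) (Fin 2 × Fin 2) ℂ :=
  ((ω / 2 : ℝ) : ℂ) • (pauliZ ⊗ₖ (1 : Matrix (Fin 2) (Fin 2) ℂ)) + 1 + (g : ℂ) • swapGate

/-- The free evolution `exp(-i t H)`. -/
def evolution (g ω t : ℝ) : Matrix (Fin 2 × Fin 2) (Fin 2 × Fin 2) ℂ :=
  NormedSpace.exp ((-(Complex.I * (t : ℂ))) • hamiltonian g ω)

/-- Adjoin the environment in the state `|0⟩⟨0|` to an operator on system ⊗ ancilla; the result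
acts on (system ⊗ environment) ⊗ ancilla. -/
def adjoinEnv {d : ℕ} (ρ : Matrix (Fin 2 × Fin d) (Fin 2 × Fin d) ℂ) :
    Matrix ((Fin 2 × Fin 2) × Fin d) ((Fin 2 × Fin 2) × Fin d) ℂ :=
  Matrix.of fun p q =>
    if p.1.2 = 0 ∧ q.1.2 = 0 then ρ (p.1.1, p.2) (q.1.1, q.2) else 0

/-- Partial trace over the environment. -/
def traceEnv {d : ℕ} (σ : Matrix ((Fin 2 × Fin 2) × Fin d) ((Fin 2 × Fin 2) × Fin d) ℂ) :
    Matrix (Fin 2 × Fin d) (Fin 2 × Fin d) ℂ :=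
  Matrix.of fun p q => ∑ e : Fin 2, σ ((p.1, e), p.2) ((q.1, e), q.2)

/-- The state of system ⊗ ancilla after joint free evolution for the actual duration `t`,
starting from the probe state `ρ` and the environment state `|0⟩`. -/
def finalState (g ω t : ℝ) {d : ℕ} (ρ : DensityMatrix (Fin 2 × Fin d)) :
    Matrix (Fin 2 × Fin d) (Fin 2 × Fin d) ℂ :=
  let U := evolution g ω t ⊗ₖ (1 : Matrix (Fin d) (Fin d) ℂ)
  traceEnv (U * adjoinEnv ρ.mat * Uᴴ)

/-- `L` is a symmetric logarithmic derivative at `ω` of the family of states `ρ`. The derivative of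
the matrix-valued function is taken entrywise. -/
def IsSLD {n : Type} [Fintype n] (ρ : ℝ → Matrix n n ℂ) (ω : ℝ) (L : Matrix n n ℂ) : Prop :=
  L.IsHermitian ∧
    (Matrix.of fun i j => deriv (fun w => ρ w i j) ω) = (1 / 2 : ℂ) • (ρ ω * L + L * ρ ω)

/-- The quantum Fisher information `Tr(ρ L²)`, `L` a symmetric logarithmic derivative. The value is
the same for every such `L`; it is `∞` when there is none. -/
def qfi {n : Type} [Fintype n] (ρ : ℝ → Matrix n n ℂ) (ω : ℝ) : ℝ≥0∞ :=
  ⨅ (L : Matrix n n ℂ) (_ : IsSLD ρ ω L), ENNReal.ofReal ((ρ ω * L * L).trace.re)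

/-- The quantum Fisher information about `ω` of the state before the measurement, maximized over
all free-evolution strategies (every ancilla dimension, every probe state), when the actual
duration of the evolution is `t`. -/
def qfiFE (g ω t : ℝ) : ℝ≥0∞ :=
  ⨆ (d : ℕ) (ρ : DensityMatrix (Fin 2 × Fin d)), qfi (fun w => finalState g w t ρ) ω

/-- A free-evolution strategy with `ν` repetitions: an ancilla, a probe state of system ⊗ ancilla, a
measurement (a POVM on system ⊗ ancilla), and an estimator that maps the `ν` outcomes to a number. -/
structure FEStrategy (ν : ℕ) where
  ancillaDim : ℕ
  probe : DensityMatrix (Fin 2 × Fin ancillaDim)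
  numOutcomes : ℕ
  povm : Fin numOutcomes → Matrix (Fin 2 × Fin ancillaDim) (Fin 2 × Fin ancillaDim) ℂ
  povm_posSemidef : ∀ x, (povm x).PosSemidef
  povm_sum : ∑ x, povm x = 1
  estimator : (Fin ν → Fin numOutcomes) → ℝ

namespace FEStrategy

variable {ν : ℕ} (s : FEStrategy ν)

/-- Probability of the outcome `x` in one run whose actual duration is `t` (Born rule). -/
def prob (g ω t : ℝ) (x : Fin s.numOutcomes) : ℝ :=
  ((finalState g ω t s.probe * s.povm x).trace).re

/-- The effective single-run outcome distribution `p_f`: the set duration `T` becomes `T (1 + u)`,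
with `u` distributed according to `f`. -/
def effProb (g ω T : ℝ) (f : ProbabilityMeasure ℝ) (x : Fin s.numOutcomes) : ℝ :=
  ∫ u, s.prob g ω (T * (1 + u)) x ∂(f : Measure ℝ)

/-- Expectation of a function of `ν` independent outcomes distributed according to `p_f`. -/
def expect (g ω T : ℝ) (f : ProbabilityMeasure ℝ)
    (F : (Fin ν → Fin s.numOutcomes) → ℝ) : ℝ :=
  ∑ x, (∏ i, s.effProb g ω T f (x i)) * F x

/-- The bias `E(ω̂) - ω`. -/
def bias (g ω T : ℝ) (f : ProbabilityMeasure ℝ) : ℝ :=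
  s.expect g ω T f s.estimator - ω

/-- The mean squared error `E[(ω̂ - ω)²]`. -/
def mse (g ω T : ℝ) (f : ProbabilityMeasure ℝ) : ℝ :=
  s.expect g ω T f fun x => (s.estimator x - ω) ^ 2

/-- The bias, as a function `b` of the frequency, has near the true value `ω` the form `m ω` of a
linear function vanishing at the reference value `0`, where `m = b'(ω)`, up to a
remainder of size at most `κ |ω|`. -/
def BiasLinear (κ g ω T : ℝ) (f : ProbabilityMeasure ℝ) : Prop :=
  |s.bias g ω T f - deriv (fun w => s.bias g w T f) ω * ω| ≤ κ * |ω|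

end FEStrategy

/-- All distributions of the time imperfection that are supported in `[-ε, ε]`. -/
def boundedTDI (ε : ℝ) : Set (ProbabilityMeasure ℝ) :=
  {f | (f : Measure ℝ) (Set.Icc (-ε) ε)ᶜ = 0}

/-- The delta distributions `δ(u - ξ)` with `ξ ∈ [-ε, ε]`. -/
def deltaTDI (ε : ℝ) : Set (ProbabilityMeasure ℝ) :=
  {f | ∃ ξ ∈ Set.Icc (-ε) ε, (f : Measure ℝ) = Measure.dirac ξ}

/-- The loss `L_FE = inf_s sup_f R(f, s)`: `f` ranges over the set `𝒩`, and `s` over the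
free-evolution strategies whose bias is linear up to relative size `κ` for each `f` in `𝒩`. -/
def lossFE (κ : ℝ) (𝒩 : Set (ProbabilityMeasure ℝ)) (ν : ℕ) (g ω T : ℝ) : ℝ≥0∞ :=
  ⨅ (s : FEStrategy ν) (_ : ∀ f ∈ 𝒩, s.BiasLinear κ g ω T f),
    ⨆ f ∈ 𝒩, ENNReal.ofReal (s.mse g ω T f)

/-- `Ω = √(g² + ω²/4)`. -/
def rabi (g ω : ℝ) : ℝ := Real.sqrt (g ^ 2 + ω ^ 2 / 4)

/-- The threshold `ε* = π / (2ΩT)`. -/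
def epsStar (g ω T : ℝ) : ℝ := Real.pi / (2 * rabi g ω * T)

/-- The Heisenberg limit `1 / (ν T²)`. -/
def heisenbergLimit (ν : ℕ) (T : ℝ) : ℝ := 1 / (ν * T ^ 2)

/-- The lower bound `g²ω² / (νω⁴T² + g²)` for `ε ≥ ε*`. -/
def boundLarge (ν : ℕ) (g ω T : ℝ) : ℝ :=
  g ^ 2 * ω ^ 2 / (ν * ω ^ 4 * T ^ 2 + g ^ 2)

/-- The lower bound `1 / {νT² [ω²/g² + cos²(εTΩ)] + ω⁻²}` for `ε < ε*`. -/
def boundSmall (ν : ℕ) (g ω T ε : ℝ) : ℝ :=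
  1 / (ν * T ^ 2 * (ω ^ 2 / g ^ 2 + Real.cos (ε * T * rabi g ω) ^ 2) + 1 / ω ^ 2)

end TDI

end

/-! The loss is bounded below by testing a strategy against one delta distribution only, so a single
actual duration t = T(1+ξ) has to be understood. There the bias-optimized bound is one
Cauchy–Schwarz inequality between the error and the total score shifted by -1/ω (`sq_le_mse_mul`).
The pairing of the two is 1 + b' - b/ω, which linearity of the bias keeps above 1 - κ whatever the
slope b', while the shifted score has second moment 1/ω² plus ν times the one-run Fisher
information. That information is at most the quantum one (`exists_score_of_isSLD`).

For the quantum Fisher information: the coupling conserves the number of excitations and the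
environment starts in |0⟩, so the channel is amplitude damping with two Kraus operators. The
amplitude out of |0⟩ is a pure phase, those out of |1⟩ are Rabi oscillations of frequency Ω. The
final state is A Aᴴ, and if its derivative is B Aᴴ + A Bᴴ the information is at most 4 Tr(B Bᴴ)
(`re_trace_sld_sq_le`). Giving the first Kraus operator an ω-dependent phase leaves the state alone
but changes B, so the rotation rate x of that phase is a free parameter (`qfiFE_le`). Minimizing the
leading part over x yields the QFI bounds (`strong_rate_bound`).

For the loss the simpler rate x = t/2 suffices (`qfiFE_le_half_rate`). Up to O(ω²t²/g²) the bound is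
then at most (θ cos θ + sin θ)²/Ω² with θ = Ωt. In a phase window of half-width ψ ≤ π/2 around ΩT
some θ makes this at most about T² cos² ψ (`exists_small_mul_cos_add_sin`). Time imperfection ε
opens the window ψ = εΩT; at ε = ε* it reaches π/2, the cosine vanishes and only the ω²T²/g² term is
left. Both loss bounds are thus instances of `phase_range_bound_le_lossFE`. -/

namespace TDI

/-! ### Symmetric logarithmic derivatives of factored states -/

section Matrices

variable {n m : Type} [Fintype n] [Fintype m]

/-- A positive semidefinite matrix has a square root factor. -/
lemma exists_eq_mul_conjTranspose [DecidableEq n] {A : Matrix n n ℂ} (hA : A.PosSemidef) :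
    ∃ Z : Matrix n n ℂ, A = Z * Zᴴ := by
  open scoped MatrixOrder in
  obtain ⟨B, hB⟩ := CStarAlgebra.nonneg_iff_eq_star_mul_self.mp hA.nonneg
  exact ⟨Bᴴ, by rw [Matrix.conjTranspose_conjTranspose]; exact hB⟩

lemma re_trace_mul_conjTranspose (A B : Matrix n m ℂ) :
    (A * Bᴴ).trace.re = (B * Aᴴ).trace.re := by
  have h : (A * Bᴴ).trace = star (B * Aᴴ).trace := by
    rw [← Matrix.trace_conjTranspose, Matrix.conjTranspose_mul, Matrix.conjTranspose_conjTranspose]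
  rw [h]; rfl

lemma re_trace_mul_conjTranspose_self (A : Matrix n m ℂ) :
    (A * Aᴴ).trace.re = ∑ i, ∑ j, ‖A i j‖ ^ 2 := by
  simp only [Matrix.trace, Matrix.diag, Matrix.mul_apply, Matrix.conjTranspose_apply,
    Complex.re_sum]
  refine Finset.sum_congr rfl fun i _ => Finset.sum_congr rfl fun j _ => ?_
  rw [Complex.star_def, Complex.mul_conj, Complex.ofReal_re, Complex.normSq_eq_norm_sq]

lemma re_trace_mul_nonneg [DecidableEq n] {A B : Matrix n n ℂ} (hA : A.PosSemidef)
    (hB : B.PosSemidef) : 0 ≤ (A * B).trace.re := by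
  obtain ⟨Z, rfl⟩ := exists_eq_mul_conjTranspose hA
  have h := (hB.conjTranspose_mul_mul_same Z).trace_nonneg
  rw [Matrix.mul_assoc, Matrix.trace_mul_comm]
  exact (Complex.nonneg_iff.mp h).1

/-- A family `A Aᴴ` with derivative `B Aᴴ + A Bᴴ` has a symmetric logarithmic derivative. -/
lemma exists_sld_of_factor [DecidableEq n] (A B : Matrix n m ℂ) :
    ∃ L : Matrix n n ℂ, L.IsHermitian ∧
      B * Aᴴ + A * Bᴴ = (1 / 2 : ℂ) • (A * Aᴴ * L + L * (A * Aᴴ)) := by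
  have hP : (A * Aᴴ).PosSemidef := Matrix.posSemidef_self_mul_conjTranspose A
  set V : Matrix n n ℂ := (hP.isHermitian.eigenvectorUnitary : Matrix n n ℂ) with hV
  set p := hP.isHermitian.eigenvalues with hp
  have hp0 : ∀ i, 0 ≤ p i := hP.eigenvalues_nonneg
  have hVV : Vᴴ * V = 1 := Unitary.coe_star_mul_self hP.isHermitian.eigenvectorUnitary
  have hVV' : V * Vᴴ = 1 := Unitary.coe_mul_star_self hP.isHermitian.eigenvectorUnitary
  have hdiag : A * Aᴴ = V * diagonal (fun i => (p i : ℂ)) * Vᴴ := by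
    have := hP.isHermitian.spectral_theorem
    rw [Unitary.conjStarAlgAut_apply] at this
    exact this
  have hD : (Vᴴ * A) * (Vᴴ * A)ᴴ = diagonal (fun i => (p i : ℂ)) := by
    rw [Matrix.conjTranspose_mul, Matrix.conjTranspose_conjTranspose,
      show Vᴴ * A * (Aᴴ * V) = Vᴴ * (A * Aᴴ) * V by simp only [Matrix.mul_assoc], hdiag,
      show Vᴴ * (V * diagonal (fun i => (p i : ℂ)) * Vᴴ) * V
        = (Vᴴ * V) * diagonal (fun i => (p i : ℂ)) * (Vᴴ * V) by simp only [Matrix.mul_assoc],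
      hVV, Matrix.one_mul, Matrix.mul_one]
  set A' := Vᴴ * A with hA'
  set B' := Vᴴ * B with hB'
  set R := B' * A'ᴴ + A' * B'ᴴ with hR
  have hRH : R.IsHermitian := by
    rw [Matrix.IsHermitian, hR, Matrix.conjTranspose_add, Matrix.conjTranspose_mul B',
      Matrix.conjTranspose_mul A', Matrix.conjTranspose_conjTranspose,
      Matrix.conjTranspose_conjTranspose, add_comm]
  -- A zero eigenvalue kills the whole row of the factor, hence `R i j = 0` whenever `p i + p j =
  -- 0`. This is what makes the equation solvable for states without full rank.
  have hrow : ∀ i, p i = 0 → ∀ k, A' i k = 0 := by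
    intro i hi
    have h1 : (A' * A'ᴴ) i i = 0 := by rw [hD]; simp [hi]
    have h2 : ∑ k, ‖A' i k‖ ^ 2 = 0 := by
      have h3 : (A' * A'ᴴ) i i = ((∑ k, ‖A' i k‖ ^ 2 : ℝ) : ℂ) := by
        rw [Matrix.mul_apply, Complex.ofReal_sum]
        refine Finset.sum_congr rfl fun k _ => ?_
        rw [Matrix.conjTranspose_apply, Complex.star_def, Complex.mul_conj,
          Complex.normSq_eq_norm_sq]
      rw [h3] at h1
      exact_mod_cast h1
    intro k
    have := (Finset.sum_eq_zero_iff_of_nonneg fun k _ => by positivity).mp h2 k (Finset.mem_univ k)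
    simpa using this
  -- In an eigenbasis of the state the equation decouples into (p i + p j) L' i j = 2 R i j. On the
  -- kernel block, division by zero returns 0, which is a valid choice there.
  let L' : Matrix n n ℂ := Matrix.of fun i j => 2 * R i j / ((p i + p j : ℝ) : ℂ)
  have hL' : L'.IsHermitian := by
    ext i j
    have := hRH.apply i j
    simp only [Matrix.conjTranspose_apply, L', Matrix.of_apply]
    rw [← this, star_div₀, star_mul', Complex.star_def, Complex.conj_ofReal, add_comm (p j),
      Complex.conj_ofNat]
  have hSLD : R = (1 / 2 : ℂ) • (diagonal (fun i => (p i : ℂ)) * L'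
      + L' * diagonal (fun i => (p i : ℂ))) := by
    ext i j
    simp only [Matrix.smul_apply, Matrix.add_apply, Matrix.diagonal_mul, Matrix.mul_diagonal, L',
      Matrix.of_apply, smul_eq_mul]
    by_cases h : p i + p j = 0
    · have hi : p i = 0 := by linarith [hp0 i, hp0 j]
      have hj : p j = 0 := by linarith [hp0 i, hp0 j]
      have : R i j = 0 := by
        simp only [hR, Matrix.add_apply, Matrix.mul_apply, Matrix.conjTranspose_apply,
          hrow i hi, hrow j hj]
        simp
      rw [this]; simp
    · have h' : ((p i + p j : ℝ) : ℂ) ≠ 0 := by exact_mod_cast h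
      field_simp
      push_cast
      ring
  have back : ∀ X : Matrix n n ℂ, V * (Vᴴ * X * V) * Vᴴ = X := by
    intro X
    rw [show V * (Vᴴ * X * V) * Vᴴ = (V * Vᴴ) * X * (V * Vᴴ) by simp only [Matrix.mul_assoc],
      hVV', Matrix.one_mul, Matrix.mul_one]
  refine ⟨V * L' * Vᴴ, Matrix.isHermitian_mul_mul_conjTranspose V hL', ?_⟩
  have hR' : R = Vᴴ * (B * Aᴴ + A * Bᴴ) * V := by
    simp only [hR, hA', hB', Matrix.conjTranspose_mul, Matrix.conjTranspose_conjTranspose,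
      Matrix.mul_add, Matrix.add_mul, Matrix.mul_assoc]
  rw [← back (B * Aᴴ + A * Bᴴ), ← hR', hSLD, hdiag]
  have hx : ∀ X Y : Matrix n n ℂ, V * X * Vᴴ * (V * Y * Vᴴ) = V * (X * Y) * Vᴴ := by
    intro X Y
    rw [show V * X * Vᴴ * (V * Y * Vᴴ) = V * X * (Vᴴ * V) * Y * Vᴴ by
      simp only [Matrix.mul_assoc], hVV, Matrix.mul_one]
    simp only [Matrix.mul_assoc]
  rw [hx, hx, Matrix.mul_smul, Matrix.smul_mul, Matrix.mul_add, Matrix.add_mul]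

/-- `Tr(ρ L²) ≤ 4 Tr(B Bᴴ)` when `ρ = A Aᴴ` and the derivative of `ρ` is `B Aᴴ + A Bᴴ`. -/
lemma re_trace_sld_sq_le (A B : Matrix n m ℂ) {L : Matrix n n ℂ} (hL : L.IsHermitian)
    (h : B * Aᴴ + A * Bᴴ = (1 / 2 : ℂ) • (A * Aᴴ * L + L * (A * Aᴴ))) :
    (A * Aᴴ * L * L).trace.re ≤ 4 * (B * Bᴴ).trace.re := by
  -- Expand ‖2B - LA‖² ≥ 0 in the Frobenius norm. By the defining equation of `L` the cross term
  -- contributes -2 Tr(ρL²) against +Tr(ρL²) from the last square.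
  have h0 : 0 ≤ (((2 : ℂ) • B - L * A) * ((2 : ℂ) • B - L * A)ᴴ).trace.re := by
    rw [re_trace_mul_conjTranspose_self]; positivity
  have hLA : (L * A)ᴴ = Aᴴ * L := by rw [Matrix.conjTranspose_mul, hL.eq]
  have h2 : (((2 : ℂ) • B - L * A) * ((2 : ℂ) • B - L * A)ᴴ).trace.re
      = 4 * (B * Bᴴ).trace.re - 4 * (B * (L * A)ᴴ).trace.re + ((L * A) * (L * A)ᴴ).trace.re := by
    have h3 := re_trace_mul_conjTranspose (L * A) B
    simp only [Matrix.conjTranspose_sub, Matrix.conjTranspose_smul, Matrix.sub_mul, Matrix.mul_sub,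
      Matrix.trace_sub, Matrix.smul_mul, Matrix.mul_smul, Matrix.trace_smul, Complex.sub_re,
      smul_eq_mul, star_ofNat, Complex.mul_re, Complex.re_ofNat, Complex.im_ofNat, zero_mul,
      sub_zero, h3]
    ring
  have h4 : ((L * A) * (L * A)ᴴ).trace = (A * Aᴴ * L * L).trace := by
    rw [hLA, Matrix.trace_mul_comm]
    rw [show Aᴴ * L * (L * A) = (Aᴴ * L * L) * A by simp only [Matrix.mul_assoc],
      Matrix.trace_mul_comm]
    simp only [Matrix.mul_assoc]
  have h5 : 2 * (B * (L * A)ᴴ).trace.re = (A * Aᴴ * L * L).trace.re := by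
    have e := congrArg (fun X => (X * L).trace.re) h
    simp only [Matrix.add_mul, Matrix.trace_add, Matrix.smul_mul, Matrix.trace_smul,
      Complex.add_re] at e
    have e1 : (L * (A * Aᴴ) * L).trace = (A * Aᴴ * L * L).trace := by
      rw [Matrix.mul_assoc L, Matrix.trace_mul_comm]
    have e2 : (A * Bᴴ * L).trace.re = (B * (L * A)ᴴ).trace.re := by
      rw [← re_trace_mul_conjTranspose, Matrix.mul_assoc, Matrix.mul_assoc,
        Matrix.trace_mul_comm, Matrix.mul_assoc, Matrix.trace_mul_comm, Matrix.mul_assoc]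
    have e3 : (B * Aᴴ * L).trace.re = (B * (L * A)ᴴ).trace.re := by
      rw [hLA, Matrix.mul_assoc]
    rw [e1, e2, e3] at e
    simp only [smul_eq_mul, Complex.mul_re] at e
    simp only [Complex.div_ofNat_re, Complex.div_ofNat_im, Complex.one_re, Complex.one_im, zero_div,
      zero_mul, sub_zero, Complex.add_re] at e
    linarith
  rw [h4] at h2
  linarith

/-- The classical information of one outcome is at most its share of the quantum information. -/
lemma sld_outcome_bound [DecidableEq n] {ρ E L : Matrix n n ℂ} (hρ : ρ.PosSemidef)
    (hE : E.PosSemidef) (hL : L.IsHermitian) (c : ℝ) :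
    0 ≤ (L * ρ * L * E).trace.re
      - 2 * c * (((1 / 2 : ℂ) • (ρ * L + L * ρ)) * E).trace.re + c ^ 2 * (ρ * E).trace.re := by
  -- Positivity of (L - c)ρ(L - c) paired with `E` is a quadratic inequality in c; optimizing over c
  -- is left to `exists_score`.
  set X := L - (c : ℂ) • (1 : Matrix n n ℂ) with hX
  have hXH : Xᴴ = X := by
    rw [hX, Matrix.conjTranspose_sub, hL.eq, Matrix.conjTranspose_smul]
    simp
  have h := re_trace_mul_nonneg (hρ.mul_mul_conjTranspose_same X) hE
  rw [hXH] at h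
  have e : (X * ρ * X * E).trace.re = (L * ρ * L * E).trace.re
      - 2 * c * (((1 / 2 : ℂ) • (ρ * L + L * ρ)) * E).trace.re + c ^ 2 * (ρ * E).trace.re := by
    simp only [hX, Matrix.sub_mul, Matrix.mul_sub, Matrix.smul_mul, Matrix.mul_smul,
      Matrix.one_mul, Matrix.mul_one, Matrix.trace_sub, Matrix.trace_smul, smul_eq_mul,
      Complex.sub_re, Complex.mul_re, Complex.ofReal_re, Complex.ofReal_im, zero_mul, sub_zero,
      Matrix.add_mul, Matrix.trace_add, Complex.add_re]
    norm_num
    ring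
  rwa [e] at h

end Matrices

/-! ### The evolution on eigenvectors and the Kraus form of the channel -/

open scoped Matrix.Norms.Operator in
/-- The exponential of a matrix acts on an eigenvector by the exponential of the eigenvalue. -/
lemma exp_mulVec_of_eigenvector {n : Type} [Fintype n] [DecidableEq n] {M : Matrix n n ℂ}
    {v : n → ℂ} {z : ℂ} (h : M *ᵥ v = z • v) :
    NormedSpace.exp M *ᵥ v = Complex.exp z • v := by
  have hpow : ∀ k : ℕ, M ^ k *ᵥ v = z ^ k • v := by
    intro k
    induction k with
    | zero => simp
    | succ k ih => rw [pow_succ, ← Matrix.mulVec_mulVec, h, Matrix.mulVec_smul, ih, smul_smul,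
        pow_succ, mul_comm]
  have h1 : HasSum (fun k : ℕ => ((k.factorial : ℂ)⁻¹ • M ^ k) *ᵥ v) (NormedSpace.exp M *ᵥ v) :=
    (NormedSpace.exp_series_hasSum_exp' (𝕂 := ℂ) M).map
      (AddMonoidHom.mk' (fun X : Matrix n n ℂ => X *ᵥ v) fun X Y => Matrix.add_mulVec X Y v)
      (continuous_id.matrix_mulVec continuous_const)
  have h2 : HasSum (fun k : ℕ => ((k.factorial : ℂ)⁻¹ • z ^ k) • v) (Complex.exp z • v) := by
    rw [Complex.exp_eq_exp_ℂ]
    exact (NormedSpace.exp_series_hasSum_exp' (𝕂 := ℂ) z).smul_const v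
  refine h1.unique (h2.congr_fun ?_)
  intro k
  rw [Matrix.smul_mulVec, hpow, smul_assoc]

lemma evolution_apply (g ω t : ℝ) (p q : Fin 2 × Fin 2) :
    evolution g ω t p q = (evolution g ω t *ᵥ Pi.single q 1) p := by
  simp

lemma evolution_mulVec {g ω : ℝ} (t : ℝ) {v : Fin 2 × Fin 2 → ℂ} {z : ℂ}
    (h : hamiltonian g ω *ᵥ v = z • v) :
    evolution g ω t *ᵥ v = Complex.exp (-(Complex.I * t * z)) • v := by
  refine exp_mulVec_of_eigenvector ?_
  rw [Matrix.smul_mulVec, h, smul_smul]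
  ring_nf

lemma hamiltonian_mulVec (g ω : ℝ) (v : Fin 2 × Fin 2 → ℂ) (s e : Fin 2) :
    (hamiltonian g ω *ᵥ v) (s, e)
      = ((if s = 0 then (ω / 2 : ℂ) else -(ω / 2)) + 1) * v (s, e) + g * v (e, s) := by
  simp only [hamiltonian, Matrix.mulVec, dotProduct, Fintype.sum_prod_type, Fin.sum_univ_two,
    pauliZ, swapGate]
  fin_cases s <;> fin_cases e <;> simp <;> ring

/-- The two Kraus operators of amplitude damping with amplitudes `φ`, `a` on the diagonal and
transition amplitude `β`. -/
def ampKraus (φ a β : ℂ) : Fin 2 → Matrix (Fin 2) (Fin 2) ℂ :=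
  ![!![φ, 0; 0, a], !![0, β; 0, 0]]

/-- The amplitudes of the evolution that starts with the environment in `|0⟩`. -/
structure EnvAmplitudes (g t : ℝ) (φ a β : ℝ → ℂ) : Prop where
  kraus_eq : ∀ w s e s', evolution g w t (s, e) (s', 0) = ampKraus (φ w) (a w) (β w) e s s'
  norm_fst : ∀ w, ‖φ w‖ ^ 2 = 1
  norm_snd : ∀ w, ‖a w‖ ^ 2 + ‖β w‖ ^ 2 = 1

/-- The operator `X ↦ K_e X` applied to a factor `Z` of the probe, for both `e` side by side. -/
def krausFactor {d : ℕ} {m : Type} (K : Fin 2 → Matrix (Fin 2) (Fin 2) ℂ)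
    (Z : Matrix (Fin 2 × Fin d) m ℂ) : Matrix (Fin 2 × Fin d) (Fin 2 × m) ℂ :=
  Matrix.of fun p q => ∑ s, K q.1 p.1 s * Z (s, p.2) q.2

/-- Tracing out the environment sums over its final state e, which becomes an extra column index of
the factor. All dependence on ω then sits in a matrix that is linear in the channel amplitudes. -/
lemma finalState_eq_factor {g w t : ℝ} {d : ℕ} {m : Type} [Fintype m]
    {ρ : DensityMatrix (Fin 2 × Fin d)}
    {Z : Matrix (Fin 2 × Fin d) m ℂ} (hZ : ρ.mat = Z * Zᴴ)
    {K : Fin 2 → Matrix (Fin 2) (Fin 2) ℂ}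
    (hK : ∀ s e s', evolution g w t (s, e) (s', 0) = K e s s') :
    finalState g w t ρ = krausFactor K Z * (krausFactor K Z)ᴴ := by
  ext ⟨s, i⟩ ⟨s', i'⟩
  have hl : finalState g w t ρ (s, i) (s', i')
      = ∑ e, ∑ r, ∑ r', K e s r * ρ.mat (r, i) (r', i') * star (K e s' r') := by
    simp only [finalState, traceEnv, Matrix.of_apply]
    refine Finset.sum_congr rfl fun e _ => ?_
    simp only [Matrix.mul_apply, Fintype.sum_prod_type, Matrix.kroneckerMap_apply,
      Matrix.one_apply, adjoinEnv, Matrix.of_apply, Matrix.conjTranspose_apply, Fin.sum_univ_two,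
      ← hK]
    simp [apply_ite (starRingEnd ℂ)]
    ring
  rw [hl, Matrix.mul_apply, Fintype.sum_prod_type]
  refine Finset.sum_congr rfl fun e _ => ?_
  simp only [hZ, krausFactor, Matrix.mul_apply, Matrix.conjTranspose_apply, Matrix.of_apply,
    Fin.sum_univ_two, star_add, star_mul', Finset.mul_sum, Finset.sum_mul,
    ← Finset.sum_add_distrib]
  refine Finset.sum_congr rfl fun k _ => ?_
  ring

/-! ### Information bound with a free Kraus phase -/

section Amplitudes

variable {g t : ℝ} {φ a β : ℝ → ℂ} {d : ℕ}

/-- Each entry of the factor involves only one of the three amplitudes and one row block of `Z`, so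
no cross terms arise and the trace is weighted by the populations of |0⟩ and |1⟩. It serves both for
normalization and, with derivatives as amplitudes, for a bound independent of the probe. -/
lemma re_trace_krausFactor {m : Type} [Fintype m] (u v w : ℂ) (Z : Matrix (Fin 2 × Fin d) m ℂ) :
    (krausFactor (ampKraus u v w) Z * (krausFactor (ampKraus u v w) Z)ᴴ).trace.re
      = ‖u‖ ^ 2 * (∑ i, ∑ k, ‖Z (0, i) k‖ ^ 2)
        + (‖v‖ ^ 2 + ‖w‖ ^ 2) * (∑ i, ∑ k, ‖Z (1, i) k‖ ^ 2) := by
  rw [re_trace_mul_conjTranspose_self]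
  simp only [Fintype.sum_prod_type, Fin.sum_univ_two, krausFactor, ampKraus, Matrix.of_apply]
  simp [mul_pow, Finset.mul_sum, Finset.sum_add_distrib, add_mul]
  ring

lemma weights_eq_one {m : Type} [Fintype m] {ρ : DensityMatrix (Fin 2 × Fin d)}
    {Z : Matrix (Fin 2 × Fin d) m ℂ} (hZ : ρ.mat = Z * Zᴴ) :
    (∑ i, ∑ k, ‖Z (0, i) k‖ ^ 2) + (∑ i, ∑ k, ‖Z (1, i) k‖ ^ 2) = 1 := by
  have h := re_trace_mul_conjTranspose_self Z
  rw [← hZ, ρ.trace_eq_one] at h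
  simp only [Fintype.sum_prod_type, Fin.sum_univ_two, Complex.one_re] at h
  exact h.symm

lemma finalState_posSemidef (h : EnvAmplitudes g t φ a β) (w : ℝ)
    (ρ : DensityMatrix (Fin 2 × Fin d)) : (finalState g w t ρ).PosSemidef := by
  obtain ⟨Z, hZ⟩ := exists_eq_mul_conjTranspose ρ.posSemidef
  rw [finalState_eq_factor hZ (h.kraus_eq w)]
  exact Matrix.posSemidef_self_mul_conjTranspose _

lemma re_trace_finalState (h : EnvAmplitudes g t φ a β) (w : ℝ)
    (ρ : DensityMatrix (Fin 2 × Fin d)) : (finalState g w t ρ).trace.re = 1 := by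
  obtain ⟨Z, hZ⟩ := exists_eq_mul_conjTranspose ρ.posSemidef
  rw [finalState_eq_factor hZ (h.kraus_eq w), re_trace_krausFactor, h.norm_fst, h.norm_snd,
    one_mul, one_mul, weights_eq_one hZ]

lemma hasDerivAt_krausFactor {m : Type} {ω : ℝ} {φ' a' β' : ℂ}
    (hφ : HasDerivAt φ φ' ω) (ha : HasDerivAt a a' ω) (hβ : HasDerivAt β β' ω)
    (Z : Matrix (Fin 2 × Fin d) m ℂ) (p : Fin 2 × Fin d) (q : Fin 2 × m) :
    HasDerivAt (fun w => krausFactor (ampKraus (φ w) (a w) (β w)) Z p q)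
      (krausFactor (ampKraus φ' a' β') Z p q) ω := by
  obtain ⟨s, i⟩ := p
  obtain ⟨e, k⟩ := q
  simp only [krausFactor, Matrix.of_apply, Fin.sum_univ_two, ampKraus]
  fin_cases s <;> fin_cases e <;> simp
  · exact hφ.mul_const _
  · exact hβ.mul_const _
  · exact ha.mul_const _
  · exact hasDerivAt_const _ _

lemma hasDerivAt_mul_conjTranspose {n m : Type} [Fintype m] {A : ℝ → Matrix n m ℂ}
    {A' : Matrix n m ℂ} {ω : ℝ} (h : ∀ p q, HasDerivAt (fun w => A w p q) (A' p q) ω) (i j : n) :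
    HasDerivAt (fun w => (A w * (A w)ᴴ) i j) ((A' * (A ω)ᴴ + A ω * A'ᴴ) i j) ω := by
  simp only [Matrix.mul_apply, Matrix.conjTranspose_apply, Matrix.add_apply,
    ← Finset.sum_add_distrib]
  exact HasDerivAt.fun_sum fun k _ => (h i k).mul (h j k).star

lemma hasDerivAt_finalState (h : EnvAmplitudes g t φ a β) {ω : ℝ} {φ' a' β' : ℂ}
    (hφ : HasDerivAt φ φ' ω) (ha : HasDerivAt a a' ω) (hβ : HasDerivAt β β' ω)
    {ρ : DensityMatrix (Fin 2 × Fin d)} {m : Type} [Fintype m]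
    {Z : Matrix (Fin 2 × Fin d) m ℂ} (hZ : ρ.mat = Z * Zᴴ) (i j : Fin 2 × Fin d) :
    HasDerivAt (fun w => finalState g w t ρ i j)
      ((krausFactor (ampKraus φ' a' β') Z * (krausFactor (ampKraus (φ ω) (a ω) (β ω)) Z)ᴴ
        + krausFactor (ampKraus (φ ω) (a ω) (β ω)) Z
          * (krausFactor (ampKraus φ' a' β') Z)ᴴ) i j) ω := by
  simp only [fun w => finalState_eq_factor hZ (h.kraus_eq w)]
  exact hasDerivAt_mul_conjTranspose (fun p q => hasDerivAt_krausFactor hφ ha hβ Z p q) i j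

/-- The bound on the maximal quantum Fisher information of an amplitude damping channel that comes
from rotating the phase of its first Kraus operator at rate `x`. -/
lemma qfiFE_le (h : EnvAmplitudes g t φ a β) {ω : ℝ} {φ' a' β' : ℂ}
    (hφ : HasDerivAt φ φ' ω) (ha : HasDerivAt a a' ω) (hβ : HasDerivAt β β' ω) (x : ℝ) {M : ℝ}
    (h₀ : ‖φ' + Complex.I * x * φ ω‖ ^ 2 ≤ M)
    (h₁ : ‖a' + Complex.I * x * a ω‖ ^ 2 + ‖β'‖ ^ 2 ≤ M) :
    qfiFE g ω t ≤ ENNReal.ofReal (4 * M) := by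
  refine iSup₂_le fun d ρ => ?_
  obtain ⟨Z, hZ⟩ := exists_eq_mul_conjTranspose ρ.posSemidef
  set A := krausFactor (ampKraus (φ ω) (a ω) (β ω)) Z with hA
  set A' := krausFactor (ampKraus φ' a' β') Z with hA'
  set B := krausFactor (ampKraus (φ' + Complex.I * x * φ ω) (a' + Complex.I * x * a ω) β') Z
    with hB
  have hfin : finalState g ω t ρ = A * Aᴴ := finalState_eq_factor hZ (h.kraus_eq ω)
  have hderiv : (Matrix.of fun i j => deriv (fun w => finalState g w t ρ i j) ω)
      = A' * Aᴴ + A * A'ᴴ := by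
    ext i j
    exact (hasDerivAt_finalState h hφ ha hβ hZ i j).deriv
  -- `B` adds i x A to the columns with e = 0 only, and i x A₀A₀ᴴ cancels against its adjoint: this
  -- is the invariance under a phase of the first Kraus operator.
  have hAB : A' * Aᴴ + A * A'ᴴ = B * Aᴴ + A * Bᴴ := by
    ext ⟨s, i⟩ ⟨s', i'⟩
    simp only [Matrix.add_apply, Matrix.mul_apply, Matrix.conjTranspose_apply,
      Fintype.sum_prod_type, Fin.sum_univ_two, hA, hA', hB, krausFactor, ampKraus,
      Matrix.of_apply, ← Finset.sum_add_distrib]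
    refine Finset.sum_congr rfl fun k _ => ?_
    fin_cases s <;> fin_cases s' <;> simp <;> ring
  obtain ⟨L, hLH, hL⟩ := exists_sld_of_factor A B
  have hSLD : IsSLD (fun w => finalState g w t ρ) ω L := by
    refine ⟨hLH, ?_⟩
    rw [hderiv, hAB, hL, ← hfin]
  refine (iInf₂_le L hSLD).trans (ENNReal.ofReal_le_ofReal ?_)
  dsimp only
  rw [hfin]
  refine (re_trace_sld_sq_le A B hLH hL).trans ?_
  rw [hB, re_trace_krausFactor]
  have hw := weights_eq_one hZ
  have h0 : 0 ≤ ∑ i, ∑ k, ‖Z (0, i) k‖ ^ 2 := by positivity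
  have h1 : 0 ≤ ∑ i, ∑ k, ‖Z (1, i) k‖ ^ 2 := by positivity
  nlinarith [mul_le_mul_of_nonneg_right h₀ h0, mul_le_mul_of_nonneg_right h₁ h1]

end Amplitudes

/-! ### Explicit amplitudes: Rabi oscillation of the single excitation -/

lemma rabi_pos {g : ℝ} (hg : 0 < g) (ω : ℝ) : 0 < rabi g ω :=
  Real.sqrt_pos.mpr (by positivity)

lemma rabi_sq (g ω : ℝ) : rabi g ω ^ 2 = g ^ 2 + ω ^ 2 / 4 :=
  Real.sq_sqrt (by positivity)

lemma le_rabi {g : ℝ} (ω : ℝ) : g ≤ rabi g ω :=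
  Real.le_sqrt_of_sq_le (by nlinarith [sq_nonneg ω])

lemma hasDerivAt_rabi {g : ℝ} (hg : 0 < g) (ω : ℝ) :
    HasDerivAt (rabi g) (ω / (4 * rabi g ω)) ω := by
  have h : HasDerivAt (fun w : ℝ => g ^ 2 + w ^ 2 / 4) (ω / 2) ω :=
    ((((hasDerivAt_id ω).pow 2).div_const 4).const_add (g ^ 2)).congr_deriv
      (by simp only [id]; norm_num; ring)
  have hs := h.sqrt (by positivity)
  have : ω / 2 / (2 * Real.sqrt (g ^ 2 + ω ^ 2 / 4)) = ω / (4 * rabi g ω) := by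
    have := (rabi_pos hg ω).ne'
    rw [rabi] at *
    field_simp; norm_num
  rw [← this]
  exact hs

lemma evolution_col_zero (g ω t : ℝ) (s e : Fin 2) :
    evolution g ω t (s, e) (0, 0)
      = if s = 0 ∧ e = 0 then Complex.exp (-(Complex.I * t * (1 + g + ω / 2))) else 0 := by
  have h : hamiltonian g ω *ᵥ Pi.single (0, 0) 1
      = (1 + g + ω / 2 : ℂ) • (Pi.single (0, 0) 1 : Fin 2 × Fin 2 → ℂ) := by
    ext ⟨s, e⟩
    rw [hamiltonian_mulVec]
    fin_cases s <;> fin_cases e <;> simp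
    ring
  rw [evolution_apply, evolution_mulVec t h]
  fin_cases s <;> fin_cases e <;> simp

/-- An eigenvector of the Hamiltonian in the span of `|01⟩` and `|10⟩`. -/
noncomputable def exchangeVec (g ω μ : ℝ) : Fin 2 × Fin 2 → ℂ :=
  Pi.single (0, 1) (g : ℂ) + Pi.single (1, 0) ((μ : ℂ) - ω / 2)

lemma hamiltonian_mulVec_exchangeVec {g ω μ : ℝ} (hμ : μ ^ 2 = g ^ 2 + ω ^ 2 / 4) :
    hamiltonian g ω *ᵥ exchangeVec g ω μ = (1 + μ : ℂ) • exchangeVec g ω μ := by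
  have h : (μ : ℂ) ^ 2 = g ^ 2 + ω ^ 2 / 4 := by exact_mod_cast congrArg Complex.ofReal hμ
  ext ⟨s, e⟩
  rw [hamiltonian_mulVec]
  fin_cases s <;> fin_cases e <;> simp [exchangeVec]
  · ring
  · linear_combination -h

lemma evolution_col_one {g : ℝ} (hg : 0 < g) (ω t : ℝ) (s e : Fin 2) :
    evolution g ω t (s, e) (1, 0)
      = Complex.exp (-(Complex.I * t)) *
        (if s = 1 ∧ e = 0 then
          ((Real.cos (rabi g ω * t) : ℝ) : ℂ)
            + Complex.I * ((Real.sin (rabi g ω * t) / rabi g ω * (ω / 2) : ℝ) : ℂ)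
        else if s = 0 ∧ e = 1 then
          -(Complex.I * ((g * (Real.sin (rabi g ω * t) / rabi g ω) : ℝ) : ℂ))
        else 0) := by
  have hΩ : (rabi g ω : ℂ) ≠ 0 := by exact_mod_cast (rabi_pos hg ω).ne'
  -- The eigenvectors for μ = ±Ω share their |01⟩ component, so their difference is 2Ω|10⟩.
  have hs : (Pi.single (1, 0) 1 : Fin 2 × Fin 2 → ℂ)
      = (1 / (2 * rabi g ω) : ℂ) • (exchangeVec g ω (rabi g ω) - exchangeVec g ω (-rabi g ω)) := by
    ext ⟨s, e⟩
    fin_cases s <;> fin_cases e <;> simp [exchangeVec]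
    field_simp
    norm_num
  have e1 : Complex.exp (-(Complex.I * t * (1 + rabi g ω)))
      = Complex.exp (-(Complex.I * t)) * (((Real.cos (rabi g ω * t) : ℝ) : ℂ)
        - ((Real.sin (rabi g ω * t) : ℝ) : ℂ) * Complex.I) := by
    rw [Complex.ofReal_cos, Complex.ofReal_sin, ← Complex.cos_neg, sub_eq_add_neg,
      ← neg_mul (Complex.sin _), ← Complex.sin_neg, ← Complex.exp_mul_I, ← Complex.exp_add]
    congr 1; push_cast; ring
  have e2 : Complex.exp (-(Complex.I * t * (1 + -rabi g ω)))
      = Complex.exp (-(Complex.I * t)) * (((Real.cos (rabi g ω * t) : ℝ) : ℂ)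
        + ((Real.sin (rabi g ω * t) : ℝ) : ℂ) * Complex.I) := by
    rw [Complex.ofReal_cos, Complex.ofReal_sin, ← Complex.exp_mul_I, ← Complex.exp_add]
    congr 1; push_cast; ring
  rw [evolution_apply, hs, Matrix.mulVec_smul, Matrix.mulVec_sub,
    evolution_mulVec t (hamiltonian_mulVec_exchangeVec (rabi_sq g ω)),
    evolution_mulVec t (hamiltonian_mulVec_exchangeVec ((neg_sq _).trans (rabi_sq g ω)))]
  simp only [Complex.ofReal_neg, e1, e2, Pi.smul_apply, Pi.sub_apply, smul_eq_mul]
  generalize Real.cos (rabi g ω * t) = c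
  generalize Real.sin (rabi g ω * t) = d
  fin_cases s <;> fin_cases e <;> simp [exchangeVec] <;> field_simp <;> ring

/-- The amplitude of the transition-free evolution of `|0⟩`. -/
noncomputable def phaseAmp (g t w : ℝ) : ℂ := Complex.exp (-(Complex.I * t * (1 + g + w / 2)))

/-- The amplitude of the transition-free evolution of `|1⟩`, up to a constant phase. -/
noncomputable def stayAmp (g t w : ℝ) : ℂ :=
  ((Real.cos (rabi g w * t) : ℝ) : ℂ)
    + Complex.I * ((Real.sin (rabi g w * t) / rabi g w * (w / 2) : ℝ) : ℂ)

/-- The amplitude of the exchange of the excitation, up to a constant phase. -/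
noncomputable def exchangeAmp (g t w : ℝ) : ℂ :=
  -(Complex.I * ((g * (Real.sin (rabi g w * t) / rabi g w) : ℝ) : ℂ))

lemma norm_exp_neg_I_mul (x : ℝ) : ‖Complex.exp (-(Complex.I * x))‖ = 1 := by
  rw [show -(Complex.I * x) = ((-x : ℝ) : ℂ) * Complex.I by push_cast; ring,
    Complex.norm_exp_ofReal_mul_I]

lemma norm_ofReal_add_I_mul_sq (x y : ℝ) : ‖(x : ℂ) + Complex.I * y‖ ^ 2 = x ^ 2 + y ^ 2 := by
  rw [← Complex.normSq_eq_norm_sq, mul_comm, Complex.normSq_add_mul_I]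

lemma norm_neg_I_mul_sq (y : ℝ) : ‖-(Complex.I * (y : ℂ))‖ ^ 2 = y ^ 2 := by
  simp

lemma norm_phaseAmp (g t w : ℝ) : ‖phaseAmp g t w‖ = 1 := by
  rw [phaseAmp, show Complex.I * t * (1 + g + w / 2)
    = Complex.I * ((t * (1 + g + w / 2) : ℝ) : ℂ) by push_cast; ring, norm_exp_neg_I_mul]

lemma envAmplitudes_of_pos {g : ℝ} (hg : 0 < g) (t : ℝ) :
    EnvAmplitudes g t (phaseAmp g t) (fun w => Complex.exp (-(Complex.I * t)) * stayAmp g t w)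
      (fun w => Complex.exp (-(Complex.I * t)) * exchangeAmp g t w) where
  kraus_eq w s e s' := by
    fin_cases s'
    · have := evolution_col_zero g w t s e
      simp only [Fin.zero_eta]
      rw [this]
      fin_cases s <;> fin_cases e <;> simp [ampKraus, phaseAmp]
    · have := evolution_col_one hg w t s e
      simp only [Fin.mk_one]
      rw [this]
      fin_cases s <;> fin_cases e <;> simp [ampKraus, stayAmp, exchangeAmp]
  norm_fst w := by rw [norm_phaseAmp]; norm_num
  norm_snd w := by
    have hΩ := (rabi_pos hg w).ne'
    have h2 := rabi_sq g w
    simp only [norm_mul, norm_exp_neg_I_mul, one_mul]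
    rw [stayAmp, exchangeAmp, norm_ofReal_add_I_mul_sq, norm_neg_I_mul_sq]
    have h1 := Real.sin_sq_add_cos_sq (rabi g w * t)
    field_simp
    linear_combination 4 * (rabi g w) ^ 2 * h1 - 4 * Real.sin (rabi g w * t) ^ 2 * h2

/-- At g = 0 one has Ω = |w|/2, which is not differentiable at w = 0, so the uncoupled case needs
its own smooth amplitudes. -/
lemma envAmplitudes_zero (t : ℝ) :
    EnvAmplitudes 0 t (phaseAmp 0 t)
      (fun w => Complex.exp (-(Complex.I * t * (1 - w / 2)))) (fun _ => 0) where
  kraus_eq w s e s' := by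
    fin_cases s'
    · have := evolution_col_zero 0 w t s e
      simp only [Fin.zero_eta]
      rw [this]
      fin_cases s <;> fin_cases e <;> simp [ampKraus, phaseAmp]
    · have h : hamiltonian 0 w *ᵥ Pi.single (1, 0) 1
          = (1 - w / 2 : ℂ) • (Pi.single (1, 0) 1 : Fin 2 × Fin 2 → ℂ) := by
        ext ⟨s, e⟩
        rw [hamiltonian_mulVec]
        fin_cases s <;> fin_cases e <;> simp
        ring
      simp only [Fin.mk_one]
      rw [evolution_apply, evolution_mulVec t h]
      fin_cases s <;> fin_cases e <;> simp [ampKraus]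
  norm_fst w := by rw [norm_phaseAmp]; norm_num
  norm_snd w := by
    rw [show Complex.I * t * (1 - w / 2)
      = Complex.I * ((t * (1 - w / 2) : ℝ) : ℂ) by push_cast; ring, norm_exp_neg_I_mul]
    norm_num

lemma hasDerivAt_phaseAmp (g t ω : ℝ) :
    HasDerivAt (phaseAmp g t) (-(Complex.I * t / 2) * phaseAmp g t ω) ω := by
  have h : HasDerivAt (fun w : ℝ => -(Complex.I * t * (1 + g + (w : ℂ) / 2)))
      (-(Complex.I * t * (1 / 2))) ω :=
    (((Complex.ofRealCLM.hasDerivAt (x := ω)).div_const 2).const_add (1 + g : ℂ)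
      |>.const_mul (Complex.I * t)).neg
  exact h.cexp.congr_deriv (by rw [phaseAmp]; ring)

/-- The derivative in `ω` of `sin(Ωt)/Ω`. -/
noncomputable def sincDeriv (g t ω : ℝ) : ℝ :=
  ω / (4 * rabi g ω ^ 3)
    * (rabi g ω * t * Real.cos (rabi g ω * t) - Real.sin (rabi g ω * t))

lemma hasDerivAt_sinc {g : ℝ} (hg : 0 < g) (t ω : ℝ) :
    HasDerivAt (fun w => Real.sin (rabi g w * t) / rabi g w) (sincDeriv g t ω) ω := by
  have hΩ := (rabi_pos hg ω).ne'
  exact (((hasDerivAt_rabi hg ω).mul_const t).sin.div (hasDerivAt_rabi hg ω) hΩ).congr_deriv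
    (by rw [sincDeriv]; field_simp)

lemma hasDerivAt_stayAmp {g : ℝ} (hg : 0 < g) (t ω : ℝ) :
    HasDerivAt (stayAmp g t)
      (((-(Real.sin (rabi g ω * t) * (ω / (4 * rabi g ω) * t)) : ℝ) : ℂ)
        + Complex.I * ((sincDeriv g t ω * (ω / 2)
          + Real.sin (rabi g ω * t) / rabi g ω * (1 / 2) : ℝ) : ℂ)) ω := by
  have h1 := (((hasDerivAt_rabi hg ω).mul_const t).cos).ofReal_comp
  have h2 := ((hasDerivAt_sinc hg t ω).mul ((hasDerivAt_id ω).div_const 2)).ofReal_comp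
  exact (h1.add (h2.const_mul Complex.I)).congr_deriv (by rw [neg_mul]; rfl)

lemma hasDerivAt_exchangeAmp {g : ℝ} (hg : 0 < g) (t ω : ℝ) :
    HasDerivAt (exchangeAmp g t) (-(Complex.I * ((g * sincDeriv g t ω : ℝ) : ℂ))) ω :=
  (((hasDerivAt_sinc hg t ω).const_mul g).ofReal_comp.const_mul Complex.I).neg

/-- The bound on the maximal quantum Fisher information from rotating at rate `x`. -/
lemma qfiFE_le_of_pos {g : ℝ} (hg : 0 < g) (ω t x : ℝ) {M : ℝ}
    (h₀ : (t / 2 - x) ^ 2 ≤ M)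
    (h₁ : (Real.sin (rabi g ω * t) * (ω / (4 * rabi g ω) * t)
          + x * (Real.sin (rabi g ω * t) / rabi g ω * (ω / 2))) ^ 2
        + (sincDeriv g t ω * (ω / 2) + Real.sin (rabi g ω * t) / rabi g ω * (1 / 2)
          + x * Real.cos (rabi g ω * t)) ^ 2
        + (g * sincDeriv g t ω) ^ 2 ≤ M) :
    qfiFE g ω t ≤ ENNReal.ofReal (4 * M) := by
  refine qfiFE_le (envAmplitudes_of_pos hg t) (hasDerivAt_phaseAmp g t ω)
    ((hasDerivAt_stayAmp hg t ω).const_mul _) ((hasDerivAt_exchangeAmp hg t ω).const_mul _) x ?_ ?_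
  · rw [show -(Complex.I * t / 2) * phaseAmp g t ω + Complex.I * x * phaseAmp g t ω
      = -(Complex.I * ((t / 2 - x : ℝ) : ℂ)) * phaseAmp g t ω by push_cast; ring, norm_mul,
      mul_pow, norm_phaseAmp, norm_neg_I_mul_sq]
    simpa using h₀
  · rw [mul_left_comm (Complex.I * (x : ℂ)), ← mul_add, norm_mul, norm_mul, norm_exp_neg_I_mul, one_mul, one_mul,
      norm_neg_I_mul_sq, stayAmp]
    refine le_trans (le_of_eq ?_) h₁
    congr 1
    set S := Real.sin (rabi g ω * t)
    set C := Real.cos (rabi g ω * t)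
    set D := sincDeriv g t ω
    rw [show (((-(S * (ω / (4 * rabi g ω) * t)) : ℝ) : ℂ)
        + Complex.I * ((D * (ω / 2) + S / rabi g ω * (1 / 2) : ℝ) : ℂ))
        + Complex.I * x * ((C : ℂ) + Complex.I * ((S / rabi g ω * (ω / 2) : ℝ) : ℂ))
      = ((-(S * (ω / (4 * rabi g ω) * t) + x * (S / rabi g ω * (ω / 2))) : ℝ) : ℂ)
        + Complex.I * ((D * (ω / 2) + S / rabi g ω * (1 / 2) + x * C : ℝ) : ℂ) by
      push_cast
      linear_combination (x : ℂ) * (S / rabi g ω * (ω / 2)) * Complex.I_sq,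
      norm_ofReal_add_I_mul_sq, neg_sq]

/-! ### Choices of the rotation rate -/

/-- The bound on the maximal quantum Fisher information for the rotation rate `t / 2`. -/
lemma qfiFE_le_half_rate {g : ℝ} (hg : 0 < g) (ω t : ℝ) :
    qfiFE g ω t ≤ ENNReal.ofReal (ω ^ 2 * t ^ 2 / rabi g ω ^ 2
      + g ^ 2 / rabi g ω ^ 2
        * (t * Real.cos (rabi g ω * t) + Real.sin (rabi g ω * t) / rabi g ω) ^ 2) := by
  set G := ω ^ 2 * t ^ 2 / rabi g ω ^ 2 + g ^ 2 / rabi g ω ^ 2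
        * (t * Real.cos (rabi g ω * t) + Real.sin (rabi g ω * t) / rabi g ω) ^ 2 with hG
  have hΩ := (rabi_pos hg ω).ne'
  have hg2 : g ^ 2 = rabi g ω ^ 2 - ω ^ 2 / 4 := by rw [rabi_sq]; ring
  have h1 := Real.sin_sq_add_cos_sq (rabi g ω * t)
  have hG0 : 0 ≤ G := by positivity
  rw [show G = 4 * (G / 4) by ring]
  -- At x = t/2 the rotated derivative out of |0⟩ vanishes, so only the |1⟩ condition matters, and
  -- it holds with equality.
  refine qfiFE_le_of_pos hg ω t (t / 2) (by rw [sub_self, zero_pow two_ne_zero]; linarith) (le_of_eq ?_)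
  rw [hG, mul_pow g, hg2, sincDeriv]
  generalize rabi g ω = Ω at *
  generalize Real.cos (Ω * t) = c at *
  generalize Real.sin (Ω * t) = s at *
  rw [← sub_eq_zero]
  have e : ω ^ 2 * t ^ 2 / (4 * Ω ^ 2) * (s ^ 2 + c ^ 2 - 1) = 0 := by rw [h1, sub_self, mul_zero]
  rw [← e]
  field_simp
  ring

/-- With u = sin(Ωt)/Ω this is the cost of writing sin(Ωt)/g instead. The relative error Ω/g - 1 is
at most ω²/(8g²), because Ω² - g² = ω²/4 and Ω ≥ g. -/
lemma sq_sub_sq_le_of_strong {g ω Ω t u c : ℝ} (hg : 0 < g) (hgΩ : g ≤ Ω)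
    (h2 : Ω ^ 2 = g ^ 2 + ω ^ 2 / 4) (hω : |ω| ≤ g) (hu : |u| ≤ |t|) (htc : |t * c| ≤ |t|) :
    (t * c + u) ^ 2 - (t * c + Ω * u / g) ^ 2 ≤ ω ^ 2 * t ^ 2 / g ^ 2 := by
  set h := t * c + u with hh
  have habs : |h| ≤ 2 * |t| := (abs_add_le _ _).trans (by linarith)
  have hω2 : ω ^ 2 ≤ g ^ 2 := sq_le_sq.mpr (by rwa [abs_of_pos hg])
  have hΩg : Ω - g ≤ ω ^ 2 / (8 * g) := by
    rw [le_div_iff₀ (by positivity)]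
    have : ω ^ 2 - (Ω - g) * (8 * g) = 4 * (Ω - g) ^ 2 := by linear_combination -4 * h2
    linarith [sq_nonneg (Ω - g)]
  set k := (Ω - g) / g with hk
  have hk0 : 0 ≤ k := div_nonneg (by linarith) hg.le
  have hk1 : k ≤ ω ^ 2 / (8 * g ^ 2) := by
    rw [hk, div_le_iff₀ hg]
    refine hΩg.trans (le_of_eq ?_)
    field_simp
  have hk2 : k ≤ 1 / 8 := by
    refine hk1.trans ?_
    rw [div_le_div_iff₀ (by positivity) (by norm_num)]; linarith
  have e2 : Ω * u / g = u + k * u := by rw [hk]; field_simp; ring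
  rw [e2]
  have e3 : h ^ 2 - (t * c + (u + k * u)) ^ 2 = -(k * (u * (2 * h + k * u))) := by
    rw [hh]; ring
  rw [e3]
  have h4 : |u * (2 * h + k * u)| ≤ |t| * (5 * |t|) := by
    rw [abs_mul]
    refine mul_le_mul hu ?_ (abs_nonneg _) (abs_nonneg _)
    refine (abs_add_le _ _).trans ?_
    rw [abs_mul, abs_mul, abs_of_nonneg hk0, abs_of_pos (two_pos : (0 : ℝ) < 2)]
    nlinarith [mul_le_mul hk2 hu (abs_nonneg u) (by norm_num), abs_nonneg t]
  have h5 := (abs_le.mp h4).1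
  rw [mul_left_comm |t|, ← sq, sq_abs] at h5
  calc -(k * (u * (2 * h + k * u))) ≤ k * (5 * t ^ 2) := by nlinarith
    _ ≤ ω ^ 2 / (8 * g ^ 2) * (5 * t ^ 2) := by gcongr
    _ = 5 / 8 * (ω ^ 2 * t ^ 2 / g ^ 2) := by field_simp
    _ ≤ _ := by
      have : 0 ≤ ω ^ 2 * t ^ 2 / g ^ 2 := by positivity
      linarith

/-- Sorts the sum of the two conditions at rate x = t/2 - y into a quadratic in y, the leading part,
and a remainder carrying the factor ω²/(4Ω²). -/
lemma rate_identity {g ω Ω t u c : ℝ} (hΩ : 0 < Ω) (h2 : Ω ^ 2 = g ^ 2 + ω ^ 2 / 4)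
    (hs : (Ω * u) ^ 2 + c ^ 2 = 1) (y : ℝ) :
    4 * (y ^ 2 + ((Ω * u * (ω / (4 * Ω) * t) + (t / 2 - y) * (u * (ω / 2))) ^ 2
        + (ω / (4 * Ω ^ 2) * (t * c - u) * (ω / 2) + u * (1 / 2) + (t / 2 - y) * c) ^ 2
        + (g * (ω / (4 * Ω ^ 2) * (t * c - u))) ^ 2))
      = (4 * y ^ 2 * (1 + c ^ 2) - 4 * y * c * (t * c + u) + (t * c + u) ^ 2)
        + ω ^ 2 / (4 * Ω ^ 2) * (4 * y ^ 2 * (Ω * u) ^ 2 - 8 * y * t + 4 * y * c * (t * c + u)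
          + 4 * t ^ 2 - (t * c + u) ^ 2) := by
  have hg2 : g ^ 2 = Ω ^ 2 - ω ^ 2 / 4 := by linarith
  have e0 : ω ^ 2 / (4 * Ω ^ 2) * (4 * t ^ 2 - 8 * y * t) * ((Ω * u) ^ 2 + c ^ 2 - 1) = 0 := by
    rw [hs, sub_self, mul_zero]
  rw [mul_pow g, hg2, ← sub_eq_zero, ← e0]
  field_simp
  ring

/-- The prescribed y minimizes the leading quadratic 4y²(1+c²) - 4ych + h², h = tc + u, with minimum
h²/(1+c²). All else is O(ω²t²/g²): 6 units from the remainder and 1 from replacing Ω by g. -/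
lemma strong_rate_bound {g ω Ω t u c : ℝ} (hg : 0 < g) (hΩ : 0 < Ω) (hgΩ : g ≤ Ω)
    (h2 : Ω ^ 2 = g ^ 2 + ω ^ 2 / 4) (hω : |ω| ≤ g) (hu : |u| ≤ |t|)
    (hs : (Ω * u) ^ 2 + c ^ 2 = 1) {y : ℝ} (hy : y = c * (t * c + u) / (2 * (1 + c ^ 2))) :
    4 * (y ^ 2 + ((Ω * u * (ω / (4 * Ω) * t) + (t / 2 - y) * (u * (ω / 2))) ^ 2
        + (ω / (4 * Ω ^ 2) * (t * c - u) * (ω / 2) + u * (1 / 2) + (t / 2 - y) * c) ^ 2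
        + (g * (ω / (4 * Ω ^ 2) * (t * c - u))) ^ 2))
      ≤ (t * c + Ω * u / g) ^ 2 / (1 + c ^ 2) + 7 * (ω ^ 2 * t ^ 2 / g ^ 2) := by
  obtain ⟨h, hh⟩ : ∃ h, h = t * c + u := ⟨_, rfl⟩
  rw [← hh] at hy
  have hc : |c| ≤ 1 := abs_le_one_iff_mul_self_le_one.mpr (by nlinarith [sq_nonneg (Ω * u)])
  have htc : |t * c| ≤ |t| := by
    rw [abs_mul]; nlinarith [abs_nonneg t]
  have habs : |h| ≤ 2 * |t| := hh ▸ (abs_add_le _ _).trans (by linarith)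
  have hyb : |y| ≤ |t| := by
    rw [hy, abs_div, abs_mul, abs_of_pos (show 0 < 2 * (1 + c ^ 2) by positivity),
      div_le_iff₀ (by positivity)]
    have : |c| * |h| ≤ 1 * (2 * |t|) := mul_le_mul hc habs (abs_nonneg _) zero_le_one
    nlinarith [abs_nonneg t, mul_nonneg (abs_nonneg t) (sq_nonneg c)]
  have e := rate_identity (t := t) hΩ h2 hs y
  rw [← hh] at e
  have e1 : 4 * y ^ 2 * (1 + c ^ 2) - 4 * y * c * h + h ^ 2 = h ^ 2 / (1 + c ^ 2) := by
    have : 1 + c ^ 2 ≠ 0 := by positivity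
    rw [hy]; field_simp; ring
  have hb1 : 4 * y ^ 2 * (Ω * u) ^ 2 ≤ 4 * t ^ 2 := by
    have : y ^ 2 ≤ t ^ 2 := sq_le_sq.mpr hyb
    have h3 : (Ω * u) ^ 2 ≤ 1 := by linarith [sq_nonneg c]
    linarith [mul_le_mul_of_nonneg_left h3 (sq_nonneg y)]
  have hb2 : -(8 * y * t) ≤ 8 * t ^ 2 := by
    have : |y * t| ≤ t ^ 2 := by
      rw [abs_mul, ← sq_abs t, sq]; exact mul_le_mul_of_nonneg_right hyb (abs_nonneg t)
    linarith [(abs_le.mp this).1]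
  have hb3 : 4 * y * c * h ≤ 8 * t ^ 2 := by
    have : |y * (c * h)| ≤ |t| * (1 * (2 * |t|)) := by
      rw [abs_mul, abs_mul]
      exact mul_le_mul hyb (mul_le_mul hc habs (abs_nonneg _) zero_le_one)
        (by positivity) (abs_nonneg t)
    have h3 := (abs_le.mp this).2
    rw [one_mul, mul_left_comm |t|, ← sq, sq_abs] at h3
    linarith
  have hr : ω ^ 2 / (4 * Ω ^ 2) ≤ ω ^ 2 / (4 * g ^ 2) := by gcongr
  -- 24 = 4 + 8 + 8 + 4 collects `hb1`, `hb2`, `hb3` and the term 4t².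
  have hb4 : ω ^ 2 / (4 * Ω ^ 2) * (4 * y ^ 2 * (Ω * u) ^ 2 - 8 * y * t + 4 * y * c * h
      + 4 * t ^ 2 - h ^ 2) ≤ 6 * (ω ^ 2 * t ^ 2 / g ^ 2) := by
    calc _ ≤ ω ^ 2 / (4 * Ω ^ 2) * (24 * t ^ 2) := by
          gcongr; linarith [sq_nonneg h]
      _ ≤ ω ^ 2 / (4 * g ^ 2) * (24 * t ^ 2) := by gcongr
      _ = _ := by ring
  have hb5 := sq_sub_sq_le_of_strong hg hgΩ h2 hω hu htc
  rw [← hh] at hb5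
  have hb6 : h ^ 2 / (1 + c ^ 2)
      ≤ (t * c + Ω * u / g) ^ 2 / (1 + c ^ 2) + ω ^ 2 * t ^ 2 / g ^ 2 := by
    have h6 : 0 ≤ ω ^ 2 * t ^ 2 / g ^ 2 := by positivity
    rw [div_add' _ _ _ (by positivity)]
    gcongr
    linarith [mul_nonneg h6 (sq_nonneg c)]
  rw [e, e1]
  linarith

/-- The bound on the maximal quantum Fisher information in the strong-coupling regime. -/
lemma qfiFE_le_strong {g : ℝ} (hg : 0 < g) {ω : ℝ} (hω : |ω| ≤ g) (t : ℝ) :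
    qfiFE g ω t ≤ ENNReal.ofReal
      (2 * (g * t * Real.cos (rabi g ω * t) + Real.sin (rabi g ω * t)) ^ 2
        / (g ^ 2 * (Real.cos (2 * t * rabi g ω) + 3)) + 7 * (ω ^ 2 * t ^ 2 / g ^ 2)) := by
  have hΩ := rabi_pos hg ω
  set Ω := rabi g ω with hΩdef
  set c := Real.cos (Ω * t) with hc
  set s := Real.sin (Ω * t) with hs
  have hsu : Ω * (s / Ω) = s := by field_simp
  have hu : |s / Ω| ≤ |t| := by
    rw [abs_div, abs_of_pos hΩ, div_le_iff₀ hΩ]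
    refine (Real.abs_sin_le_abs).trans ?_
    rw [abs_mul, abs_of_pos hΩ, mul_comm]
  set y := c * (t * c + s / Ω) / (2 * (1 + c ^ 2)) with hy
  have key := strong_rate_bound hg hΩ (le_rabi ω) (rabi_sq g ω) hω hu
    (by rw [hsu]; exact Real.sin_sq_add_cos_sq _) hy
  rw [hsu] at key
  have hcos : Real.cos (2 * t * Ω) = 2 * c ^ 2 - 1 := by
    rw [hc, ← Real.cos_two_mul]; ring_nf
  have e : 2 * (g * t * c + s) ^ 2 / (g ^ 2 * (Real.cos (2 * t * Ω) + 3))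
      = (t * c + s / g) ^ 2 / (1 + c ^ 2) := by
    rw [hcos, show 2 * c ^ 2 - 1 + 3 = 2 * (1 + c ^ 2) by ring]
    have : 1 + c ^ 2 ≠ 0 := by positivity
    field_simp
  have hD : sincDeriv g t ω = ω / (4 * Ω ^ 2) * (t * c - s / Ω) := by
    rw [sincDeriv, ← hΩdef, ← hc, ← hs]; field_simp
  rw [e]
  refine le_trans (qfiFE_le_of_pos hg ω t (t / 2 - y) ?_ (le_add_of_nonneg_left (sq_nonneg y)))
    (ENNReal.ofReal_le_ofReal ?_)
  · rw [sub_sub_cancel]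
    exact le_add_of_nonneg_right (by positivity)
  · rw [← hΩdef, ← hc, ← hs, hD]
    exact key

/-- Since ω²T ≥ g ≥ |ω| gives |ω|T ≥ 1, and g t ≤ 2ω²T², the terms containing the sine are absorbed
in the error. The constant is 33 = 5 + 28: 5 from these terms and 28 = 7·4 from t ≤ 2T. -/
lemma qfiFE_le_strong_long {g ω T ξ : ℝ} (hg : 0 < g) (hω : |ω| ≤ g) (hT : 0 < T)
    (hgT : g ≤ ω ^ 2 * T) (hξ : |ξ| ≤ 1) :
    qfiFE g ω (T * (1 + ξ)) ≤ ENNReal.ofReal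
      (2 * T ^ 2 * (1 + ξ) ^ 2 * Real.cos (T * rabi g ω * (1 + ξ)) ^ 2
          / (Real.cos (2 * T * (1 + ξ) * rabi g ω) + 3) + 33 * (ω ^ 2 * T ^ 2 / g ^ 2)) := by
  refine (qfiFE_le_strong hg hω _).trans (ENNReal.ofReal_le_ofReal ?_)
  obtain ⟨hξ1, hξ2⟩ := abs_le.mp hξ
  rw [show T * rabi g ω * (1 + ξ) = rabi g ω * (T * (1 + ξ)) by ring,
    show 2 * T * (1 + ξ) * rabi g ω = 2 * (T * (1 + ξ)) * rabi g ω by ring,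
    show 2 * T ^ 2 * (1 + ξ) ^ 2 = 2 * (T * (1 + ξ)) ^ 2 by ring]
  have ht0 : 0 ≤ T * (1 + ξ) := mul_nonneg hT.le (by linarith)
  have ht2 : T * (1 + ξ) ≤ 2 * T := by nlinarith
  generalize T * (1 + ξ) = t at *
  have hc := Real.abs_cos_le_one (rabi g ω * t)
  have hs := Real.abs_sin_le_one (rabi g ω * t)
  have hd := Real.neg_one_le_cos (2 * t * rabi g ω)
  generalize Real.cos (rabi g ω * t) = c at *
  generalize Real.sin (rabi g ω * t) = s at *
  generalize Real.cos (2 * t * rabi g ω) = D at *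
  have hD : 0 < D + 3 := by linarith
  have hcs : c * s ≤ 1 := by
    have : |c * s| ≤ 1 * 1 := by
      rw [abs_mul]; exact mul_le_mul hc hs (abs_nonneg _) zero_le_one
    linarith [(abs_le.mp this).2]
  have hss : s ^ 2 ≤ 1 := by rw [← sq_abs]; exact pow_le_one₀ (abs_nonneg _) hs
  have hωabs : |ω| * |ω| = ω ^ 2 := by rw [← sq, sq_abs]
  have hω0 : 0 < |ω| := by
    rcases (abs_nonneg ω).eq_or_lt with h | h
    · rw [← hωabs, ← h] at hgT; linarith
    · exact h
  have hωT : 1 ≤ |ω| * T := by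
    have : |ω| * 1 ≤ |ω| * (|ω| * T) := by rw [← mul_assoc, hωabs]; linarith
    exact le_of_mul_le_mul_left this hω0
  have hωT2 : 1 ≤ ω ^ 2 * T ^ 2 := by
    rw [← sq_abs ω, ← mul_pow]; exact one_le_pow₀ hωT
  have e1 : 2 * (g * t * c + s) ^ 2 / (g ^ 2 * (D + 3))
      = 2 * t ^ 2 * c ^ 2 / (D + 3) + 2 * (2 * (g * t) * (c * s) + s ^ 2) / (g ^ 2 * (D + 3)) := by
    field_simp; ring
  have h1 : 2 * (2 * (g * t) * (c * s) + s ^ 2) / (g ^ 2 * (D + 3))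
      ≤ 5 * (ω ^ 2 * T ^ 2 / g ^ 2) := by
    rw [mul_div_assoc', div_le_div_iff₀ (by positivity) (by positivity)]
    have h2 : 2 * (2 * (g * t) * (c * s) + s ^ 2) ≤ 2 * (5 * (ω ^ 2 * T ^ 2)) := by
      have hgt : 0 ≤ g * t := by positivity
      have : g * t ≤ 2 * (ω ^ 2 * T ^ 2) := by
        calc g * t ≤ ω ^ 2 * T * (2 * T) := mul_le_mul hgT ht2 ht0 (by positivity)
          _ = _ := by ring
      nlinarith [mul_le_mul_of_nonneg_left hcs hgt]
    have h3 : 0 ≤ 5 * (ω ^ 2 * T ^ 2) := by positivity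
    nlinarith [mul_le_mul_of_nonneg_right h2 (sq_nonneg g), mul_nonneg h3 (sq_nonneg g),
      mul_nonneg (mul_nonneg h3 (sq_nonneg g)) (show 0 ≤ D + 1 by linarith)]
  have h4 : 7 * (ω ^ 2 * t ^ 2 / g ^ 2) ≤ 28 * (ω ^ 2 * T ^ 2 / g ^ 2) := by
    have : ω ^ 2 * t ^ 2 / g ^ 2 ≤ ω ^ 2 * (2 * T) ^ 2 / g ^ 2 := by gcongr
    calc _ ≤ 7 * (ω ^ 2 * (2 * T) ^ 2 / g ^ 2) := by linarith
      _ = _ := by ring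
  rw [e1]
  linarith

/-! ### A duration carrying little information -/

/-- Otherwise the continuous function θ cos θ + sin θ never vanishes on the window and keeps one
sign σ, so σ times it exceeds (A+1) cos ψ at both endpoints. The addition formulas rule this out. -/
lemma exists_small_mul_cos_add_sin {A ψ : ℝ} (hA : Real.pi / 2 ≤ A) (hψ : 0 ≤ ψ)
    (hψ' : ψ ≤ Real.pi / 2) :
    ∃ θ ∈ Set.Icc (A - ψ) (A + ψ),
      (θ * Real.cos θ + Real.sin θ) ^ 2 ≤ ((A + 1) * Real.cos ψ) ^ 2 := by
  have hcψ : 0 ≤ Real.cos ψ := Real.cos_nonneg_of_mem_Icc ⟨by linarith [Real.pi_pos], hψ'⟩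
  have hsψ : 0 ≤ Real.sin ψ := Real.sin_nonneg_of_nonneg_of_le_pi hψ (by linarith [Real.pi_pos])
  have hA0 : 0 ≤ A := by linarith [Real.pi_pos]
  have hB : 0 ≤ (A + 1) * Real.cos ψ := by positivity
  by_contra! hcon
  have main : ∀ σ : ℝ, σ ^ 2 = 1 → 0 < σ * (A * Real.cos A + Real.sin A) → False := by
    intro σ hσ hpos
    have hσ1 : |σ| ≤ 1 := abs_le_one_iff_mul_self_le_one.mpr (by nlinarith)
    set k : ℝ → ℝ := fun θ => σ * (θ * Real.cos θ + Real.sin θ) with hk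
    have hcont : Continuous k := by fun_prop
    have hmem : A ∈ Set.Icc (A - ψ) (A + ψ) := ⟨by linarith, by linarith⟩
    have hbig : ∀ θ ∈ Set.Icc (A - ψ) (A + ψ), (A + 1) * Real.cos ψ < k θ := by
      intro θ hθ
      have h1 : ((A + 1) * Real.cos ψ) ^ 2 < k θ ^ 2 := by
        have h0 := hcon θ hθ
        simp only [hk]
        rwa [mul_pow σ, hσ, one_mul]
      rcases lt_or_ge 0 (k θ) with h | h
      · exact lt_of_pow_lt_pow_left₀ 2 h.le h1
      · exfalso
        obtain ⟨z, hz, hz0⟩ := isPreconnected_Icc.intermediate_value hθ hmem hcont.continuousOn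
          ⟨h, hpos.le⟩
        have h2 := hcon z hz
        have h3 : (z * Real.cos z + Real.sin z) ^ 2 = k z ^ 2 := by
          simp only [hk]; rw [mul_pow σ, hσ, one_mul]
        rw [h3, hz0] at h2
        nlinarith [sq_nonneg ((A + 1) * Real.cos ψ)]
    have hp := hbig (A + ψ) ⟨by linarith, le_rfl⟩
    have hm := hbig (A - ψ) ⟨le_rfl, by linarith⟩
    simp only [hk, Real.cos_add, Real.sin_add, Real.cos_sub, Real.sin_sub] at hp hm
    have hc1 : σ * Real.cos A ≤ 1 := by
      have : |σ * Real.cos A| ≤ 1 * 1 := by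
        rw [abs_mul]; exact mul_le_mul hσ1 (Real.abs_cos_le_one A) (abs_nonneg _) zero_le_one
      linarith [(abs_le.mp this).2]
    have hs1 : σ * Real.sin A ≤ 1 := by
      have : |σ * Real.sin A| ≤ 1 * 1 := by
        rw [abs_mul]; exact mul_le_mul hσ1 (Real.abs_sin_le_one A) (abs_nonneg _) zero_le_one
      linarith [(abs_le.mp this).2]
    have hpos' : 0 < A * (σ * Real.cos A) + σ * Real.sin A := by linarith
    have hp' : (A + 1) * Real.cos ψ < (A + ψ) * (σ * Real.cos A * Real.cos ψ
        - σ * Real.sin A * Real.sin ψ) + (σ * Real.sin A * Real.cos ψ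
        + σ * Real.cos A * Real.sin ψ) := by linarith
    have hm' : (A + 1) * Real.cos ψ < (A - ψ) * (σ * Real.cos A * Real.cos ψ
        + σ * Real.sin A * Real.sin ψ) + (σ * Real.sin A * Real.cos ψ
        - σ * Real.cos A * Real.sin ψ) := by linarith
    generalize σ * Real.cos A = c at *
    generalize σ * Real.sin A = s at *
    generalize Real.cos ψ = C at *
    generalize Real.sin ψ = S at *
    -- For s ≥ 0 the mean of the two endpoint values is A c C - ψ s S + s C ≤ (A+1)C. For s < 0
    -- positivity at the centre forces c > 0, and then the left endpoint alone is at most A C.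
    rcases le_or_gt 0 s with hs0 | hs0
    · nlinarith [mul_nonneg (mul_nonneg hψ hs0) hsψ, mul_le_mul_of_nonneg_right hs1 hcψ,
        mul_le_mul_of_nonneg_right hc1 (mul_nonneg hA0 hcψ)]
    · have hc0 : 0 < c := by
        by_contra! h
        nlinarith
      nlinarith [mul_le_mul_of_nonneg_right hc1 (mul_nonneg hA0 hcψ),
        mul_nonneg (mul_nonneg (show 0 ≤ A - ψ by linarith) (neg_nonneg.mpr hs0.le)) hsψ,
        mul_nonneg (neg_nonneg.mpr hs0.le) hcψ, mul_nonneg hc0.le hsψ,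
        mul_nonneg hψ (mul_nonneg hc0.le hcψ)]
  rcases lt_trichotomy (A * Real.cos A + Real.sin A) 0 with h | h | h
  · exact main (-1) (by norm_num) (by linarith)
  · have := hcon A ⟨by linarith, by linarith⟩
    rw [h] at this
    nlinarith [sq_nonneg ((A + 1) * Real.cos ψ)]
  · exact main 1 (by norm_num) (by linarith)

/-- Within the phase range `ψ` there is a duration at which little can be learned about `ω`. -/
lemma exists_qfiFE_le {g ω T ψ : ℝ} (hg : 0 < g) (hT : 0 < T) (hgT : 2 ≤ g * T) (hψ : 0 ≤ ψ)
    (hψ' : ψ ≤ Real.pi / 2) :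
    ∃ ξ : ℝ, |ξ| ≤ ψ / (rabi g ω * T) ∧
      qfiFE g ω (T * (1 + ξ)) ≤ ENNReal.ofReal
        (T ^ 2 * (1 + 2 / (g * T)) ^ 2 * (ω ^ 2 / g ^ 2 + Real.cos ψ ^ 2)) := by
  have hΩ := rabi_pos hg ω
  have hgΩ : g ≤ rabi g ω := le_rabi ω
  have hpi : Real.pi ≤ 4 := Real.pi_le_four
  -- Here gT ≥ 2 enters: with π ≤ 4 it makes ΩT ≥ π/2, so the window contains only nonnegative
  -- phases.
  have hA : Real.pi / 2 ≤ rabi g ω * T := by nlinarith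
  obtain ⟨θ, ⟨hθ1, hθ2⟩, hθ⟩ := exists_small_mul_cos_add_sin hA hψ hψ'
  have hAp : 0 < rabi g ω * T := by positivity
  refine ⟨(θ - rabi g ω * T) / (rabi g ω * T), ?_, ?_⟩
  · rw [abs_div, abs_of_pos hAp]
    gcongr
    exact abs_le.mpr ⟨by linarith, by linarith⟩
  · have et : T * (1 + (θ - rabi g ω * T) / (rabi g ω * T)) = θ / rabi g ω := by
      field_simp; ring
    rw [et]
    refine (qfiFE_le_half_rate hg ω _).trans (ENNReal.ofReal_le_ofReal ?_)
    rw [mul_div_cancel₀ _ hΩ.ne']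
    have hθ0 : 0 ≤ θ := by linarith
    have eT : T ^ 2 * (1 + 2 / (g * T)) ^ 2 = (T + 2 / g) ^ 2 := by
      field_simp
    rw [eT]
    generalize rabi g ω = Ω at *
    have hinv : 2 / Ω ≤ 2 / g := by gcongr
    have ht : θ / Ω ≤ T + 2 / g := by
      calc θ / Ω ≤ (Ω * T + 2) / Ω := by gcongr; linarith
        _ = T + 2 / Ω := by field_simp
        _ ≤ _ := by linarith
    have h1 : ω ^ 2 * (θ / Ω) ^ 2 / Ω ^ 2 ≤ (T + 2 / g) ^ 2 * (ω ^ 2 / g ^ 2) := by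
      calc ω ^ 2 * (θ / Ω) ^ 2 / Ω ^ 2 ≤ ω ^ 2 * (T + 2 / g) ^ 2 / g ^ 2 := by gcongr
        _ = _ := by ring
    have h2 : g ^ 2 / Ω ^ 2 * (θ / Ω * Real.cos θ + Real.sin θ / Ω) ^ 2
        ≤ (T + 2 / g) ^ 2 * Real.cos ψ ^ 2 := by
      have ha : g ^ 2 / Ω ^ 2 ≤ 1 := by
        rw [div_le_one (by positivity)]; gcongr
      have hb : (θ / Ω * Real.cos θ + Real.sin θ / Ω) ^ 2
          = (θ * Real.cos θ + Real.sin θ) ^ 2 / Ω ^ 2 := by field_simp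
      have hc : (Ω * T + 1) / Ω ≤ T + 2 / g := by
        have : (Ω * T + 1) / Ω = T + 1 / Ω := by field_simp
        rw [this]
        have : 1 / Ω ≤ 2 / Ω := by gcongr; norm_num
        linarith
      calc g ^ 2 / Ω ^ 2 * (θ / Ω * Real.cos θ + Real.sin θ / Ω) ^ 2
          ≤ 1 * (θ / Ω * Real.cos θ + Real.sin θ / Ω) ^ 2 := by gcongr
        _ ≤ ((Ω * T + 1) * Real.cos ψ) ^ 2 / Ω ^ 2 := by rw [one_mul, hb]; gcongr
        _ = ((Ω * T + 1) / Ω) ^ 2 * Real.cos ψ ^ 2 := by ring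
        _ ≤ _ := by gcongr
    rw [mul_add]
    exact add_le_add h1 h2

/-! ### Independent samples and the biased Cramér–Rao inequality -/

section Products

variable {ν k : ℕ} {p l : Fin k → ℝ}

/-- Distributivity as the form of independence: marginals and vanishing cross terms follow by
setting most `h i` to 1. -/
lemma sum_prod_mul_prod (p : Fin k → ℝ) (h : Fin ν → Fin k → ℝ) :
    ∑ x : Fin ν → Fin k, (∏ i, p (x i)) * ∏ i, h i (x i) = ∏ i, ∑ y, p y * h i y := by
  rw [Finset.prod_univ_sum, Fintype.piFinset_univ]
  exact Finset.sum_congr rfl fun x _ => Finset.prod_mul_distrib.symm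

lemma sum_prod_eq_one (hp : ∑ y, p y = 1) : ∑ x : Fin ν → Fin k, ∏ i, p (x i) = 1 := by
  have h := sum_prod_mul_prod (ν := ν) p fun _ _ => 1
  simpa [hp] using h

lemma sum_prod_mul_apply (hp : ∑ y, p y = 1) (i : Fin ν) (h : Fin k → ℝ) :
    ∑ x : Fin ν → Fin k, (∏ j, p (x j)) * h (x i) = ∑ y, p y * h y := by
  have := sum_prod_mul_prod (ν := ν) p fun j y => if j = i then h y else 1
  simp only [Finset.prod_ite_eq', Finset.mem_univ, if_true] at this
  rw [this, Finset.prod_eq_single i]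
  · simp
  · intro j _ hj
    simp [hj, hp]
  · simp

lemma sum_prod_mul_apply_mul_apply (hl : ∑ y, p y * l y = 0) {i j : Fin ν} (hij : i ≠ j) :
    ∑ x : Fin ν → Fin k, (∏ j, p (x j)) * (l (x i) * l (x j)) = 0 := by
  have := sum_prod_mul_prod (ν := ν) p
    fun r y => (if r = i then l y else 1) * (if r = j then l y else 1)
  simp only [Finset.prod_mul_distrib, Finset.prod_ite_eq', Finset.mem_univ, if_true] at this
  rw [this]
  refine Finset.prod_eq_zero (Finset.mem_univ i) ?_
  simpa [hij] using hl

lemma sum_prod_mul_sum (hp : ∑ y, p y = 1) (hl : ∑ y, p y * l y = 0) :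
    ∑ x : Fin ν → Fin k, (∏ j, p (x j)) * ∑ i, l (x i) = 0 := by
  simp only [Finset.mul_sum]
  rw [Finset.sum_comm]
  simp [sum_prod_mul_apply hp, hl]

/-- Centered independent scores are uncorrelated, so only diagonal pairs survive: Fisher information
is additive. -/
lemma sum_prod_mul_sum_sq (hp : ∑ y, p y = 1) (hl : ∑ y, p y * l y = 0) :
    ∑ x : Fin ν → Fin k, (∏ j, p (x j)) * (∑ i, l (x i)) ^ 2 = ν * ∑ y, p y * l y ^ 2 := by
  have e : ∀ x : Fin ν → Fin k, (∏ j, p (x j)) * (∑ i, l (x i)) ^ 2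
      = ∑ i, ∑ j, (∏ j, p (x j)) * (l (x i) * l (x j)) := by
    intro x
    simp only [sq, Finset.sum_mul_sum]
    rw [Finset.mul_sum]
    exact Finset.sum_congr rfl fun i _ => Finset.mul_sum _ _ _
  have h : ∀ i : Fin ν, ∑ x : Fin ν → Fin k, ∑ j, (∏ j, p (x j)) * (l (x i) * l (x j))
      = ∑ y, p y * l y ^ 2 := by
    intro i
    rw [Finset.sum_comm, Finset.sum_eq_single i]
    · simp only [← sq]
      exact sum_prod_mul_apply hp i fun y => l y ^ 2
    · intro j _ hj
      exact sum_prod_mul_apply_mul_apply hl hj.symm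
    · simp
  rw [Finset.sum_congr rfl fun x _ => e x, Finset.sum_comm, Finset.sum_congr rfl fun i _ => h i]
  simp

/-- The score of a product is the sum of the scores. Writing each derivative as p·l avoids dividing
by a probability that may vanish. -/
lemma hasDerivAt_sum_prod_mul {p : ℝ → Fin k → ℝ} {ω : ℝ}
    (hd : ∀ y, HasDerivAt (fun w => p w y) (p ω y * l y) ω) (F : (Fin ν → Fin k) → ℝ) :
    HasDerivAt (fun w => ∑ x, (∏ i, p w (x i)) * F x)
      (∑ x, (∏ i, p ω (x i)) * (∑ i, l (x i)) * F x) ω := by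
  refine HasDerivAt.fun_sum fun x _ => HasDerivAt.mul_const ?_ _
  refine (HasDerivAt.fun_finsetProd (u := Finset.univ) fun i _ => hd (x i)).congr_deriv ?_
  rw [Finset.mul_sum]
  refine Finset.sum_congr rfl fun i _ => ?_
  rw [smul_eq_mul, ← mul_assoc, Finset.prod_erase_mul _ _ (Finset.mem_univ i)]

/-- The biased Cramér-Rao inequality for `ν` independent samples from a finite distribution, with
the score shifted by the constant `-1 / ω`. -/
lemma sq_le_mse_mul {ω κ b D : ℝ} (hω : ω ≠ 0) (hκ : κ ≤ 1) (hp0 : ∀ y, 0 ≤ p y)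
    (hp : ∑ y, p y = 1) (hl : ∑ y, p y * l y = 0) (F : (Fin ν → Fin k) → ℝ)
    (hb : b = ∑ x, (∏ i, p (x i)) * F x - ω)
    (hD : D = ∑ x, (∏ i, p (x i)) * (∑ i, l (x i)) * F x)
    (hbias : |b - (D - 1) * ω| ≤ κ * |ω|) :
    (1 - κ) ^ 2 ≤ (∑ x, (∏ i, p (x i)) * (F x - ω) ^ 2)
      * (1 / ω ^ 2 + ν * ∑ y, p y * l y ^ 2) := by
  have hW : ∀ x : Fin ν → Fin k, 0 ≤ ∏ i, p (x i) := fun x => Finset.prod_nonneg fun i _ => hp0 _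
  have h0 := sum_prod_eq_one (ν := ν) hp
  have h1 := sum_prod_mul_sum (ν := ν) hp hl
  have h2 := sum_prod_mul_sum_sq (ν := ν) hp hl
  -- The shift -1/ω is the multiplier that optimizes m²ω² + (1+m)²/(νF) over the bias slope m; the
  -- minimum is 1/(ω⁻² + νF).
  have hcs := Finset.sum_sq_le_sum_mul_sum_of_sq_le_mul (Finset.univ : Finset (Fin ν → Fin k))
    (r := fun x => (∏ i, p (x i)) * ((F x - ω) * (∑ i, l (x i) - 1 / ω)))
    (f := fun x => (∏ i, p (x i)) * (F x - ω) ^ 2)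
    (g := fun x => (∏ i, p (x i)) * (∑ i, l (x i) - 1 / ω) ^ 2)
    (fun x _ => mul_nonneg (hW x) (sq_nonneg _)) (fun x _ => mul_nonneg (hW x) (sq_nonneg _))
    (fun x _ => le_of_eq (by ring))
  have e1 : ∑ x : Fin ν → Fin k, (∏ i, p (x i)) * (∑ i, l (x i) - 1 / ω) ^ 2
      = 1 / ω ^ 2 + ν * ∑ y, p y * l y ^ 2 := by
    have : ∀ x : Fin ν → Fin k, (∏ i, p (x i)) * (∑ i, l (x i) - 1 / ω) ^ 2
        = (∏ i, p (x i)) * (∑ i, l (x i)) ^ 2 - 2 / ω * ((∏ i, p (x i)) * ∑ i, l (x i))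
          + 1 / ω ^ 2 * ∏ i, p (x i) := fun x => by ring
    simp only [this, Finset.sum_add_distrib, Finset.sum_sub_distrib, ← Finset.mul_sum, h0, h1, h2]
    ring
  have e2 : ∑ x : Fin ν → Fin k, (∏ i, p (x i)) * ((F x - ω) * (∑ i, l (x i) - 1 / ω))
      = D - b / ω := by
    have : ∀ x : Fin ν → Fin k, (∏ i, p (x i)) * ((F x - ω) * (∑ i, l (x i) - 1 / ω))
        = (∏ i, p (x i)) * (∑ i, l (x i)) * F x - 1 / ω * ((∏ i, p (x i)) * F x)
          - ω * ((∏ i, p (x i)) * ∑ i, l (x i)) + (∏ i, p (x i)) := fun x => by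
      field_simp; ring
    simp only [this, Finset.sum_add_distrib, Finset.sum_sub_distrib, ← Finset.mul_sum, h0, h1,
      ← hD]
    rw [hb]; field_simp; ring
  rw [e1, e2] at hcs
  refine le_trans ?_ hcs
  -- `D` is 1 + b', so the bias condition divided by |ω| reads |b/ω - (D - 1)| ≤ κ.
  have h3 : 1 - κ ≤ D - b / ω := by
    have e3 : b - (D - 1) * ω = ω * (b / ω - (D - 1)) := by field_simp
    rw [e3, abs_mul, mul_comm] at hbias
    have := le_of_mul_le_mul_right hbias (abs_pos.mpr hω)
    linarith [(abs_le.mp this).2]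
  exact pow_le_pow_left₀ (by linarith) h3 2

end Products

/-- A score for a finite distribution whose derivative is controlled by quadratic forms. -/
lemma exists_score {k : ℕ} {p q X : Fin k → ℝ} (hp : ∀ y, 0 ≤ p y)
    (h : ∀ y (c : ℝ), 0 ≤ X y - 2 * c * q y + c ^ 2 * p y) :
    (∀ y, p y * (q y / p y) = q y) ∧ ∑ y, p y * (q y / p y) ^ 2 ≤ ∑ y, X y := by
  refine ⟨fun y => ?_, Finset.sum_le_sum fun y _ => ?_⟩
  -- Where p vanishes the quadratic in c is affine, and nonnegativity for all c forces q = 0; the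
  -- chosen c would give the value -1.
  · rcases eq_or_ne (p y) 0 with h0 | h0
    · by_cases hq : q y = 0
      · simp [hq]
      · have := h y ((X y + 1) / (2 * q y))
        rw [h0, mul_zero, show 2 * ((X y + 1) / (2 * q y)) * q y = X y + 1 by field_simp] at this
        linarith
    · field_simp
  · rcases (hp y).eq_or_lt with h0 | h0
    · have := h y 0
      rw [← h0]; simpa using this
    -- The minimizer of the quadratic in c.
    · have := h y (q y / p y)
      field_simp at this ⊢
      linarith

/-! ### From outcome probabilities to the loss -/

lemma hasDerivAt_stayAmp_zero (t ω : ℝ) :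
    HasDerivAt (fun w : ℝ => Complex.exp (-(Complex.I * t * (1 - w / 2))))
      (Complex.I * t / 2 * Complex.exp (-(Complex.I * t * (1 - ω / 2)))) ω := by
  have h : HasDerivAt (fun w : ℝ => -(Complex.I * t * (1 - (w : ℂ) / 2)))
      (-(Complex.I * t * (-(1 / 2)))) ω :=
    (((Complex.ofRealCLM.hasDerivAt (x := ω)).div_const 2).const_sub (1 : ℂ)
      |>.const_mul (Complex.I * t)).neg
  exact h.cexp.congr_deriv (by ring)

lemma exists_envAmplitudes {g : ℝ} (hg : 0 ≤ g) (t ω : ℝ) :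
    ∃ (φ a β : ℝ → ℂ) (φ' a' β' : ℂ), EnvAmplitudes g t φ a β ∧
      HasDerivAt φ φ' ω ∧ HasDerivAt a a' ω ∧ HasDerivAt β β' ω := by
  rcases hg.eq_or_lt with rfl | hg
  · exact ⟨_, _, _, _, _, _, envAmplitudes_zero t, hasDerivAt_phaseAmp 0 t ω,
      hasDerivAt_stayAmp_zero t ω, hasDerivAt_const _ _⟩
  · exact ⟨_, _, _, _, _, _, envAmplitudes_of_pos hg t, hasDerivAt_phaseAmp g t ω,
      (hasDerivAt_stayAmp hg t ω).const_mul _, (hasDerivAt_exchangeAmp hg t ω).const_mul _⟩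

lemma hasDerivAt_finalState_deriv {g : ℝ} (hg : 0 ≤ g) (t ω : ℝ) {d : ℕ}
    (ρ : DensityMatrix (Fin 2 × Fin d)) (i j : Fin 2 × Fin d) :
    HasDerivAt (fun w => finalState g w t ρ i j)
      ((Matrix.of fun i j => deriv (fun w => finalState g w t ρ i j) ω) i j) ω := by
  obtain ⟨φ, a, β, φ', a', β', h, hφ, ha, hβ⟩ := exists_envAmplitudes hg t ω
  obtain ⟨Z, hZ⟩ := exists_eq_mul_conjTranspose ρ.posSemidef
  exact (hasDerivAt_finalState h hφ ha hβ hZ i j).differentiableAt.hasDerivAt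

namespace FEStrategy

variable {ν : ℕ} (s : FEStrategy ν) {g t : ℝ}

lemma prob_nonneg (hg : 0 ≤ g) (w : ℝ) (x : Fin s.numOutcomes) : 0 ≤ s.prob g w t x := by
  obtain ⟨φ, a, β, φ', a', β', h, -⟩ := exists_envAmplitudes hg t w
  exact re_trace_mul_nonneg (finalState_posSemidef h w s.probe) (s.povm_posSemidef x)

lemma sum_prob (hg : 0 ≤ g) (w : ℝ) : ∑ x, s.prob g w t x = 1 := by
  obtain ⟨φ, a, β, φ', a', β', h, -⟩ := exists_envAmplitudes hg t w
  simp only [prob]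
  rw [← Complex.re_sum, ← Matrix.trace_sum, ← Matrix.mul_sum, s.povm_sum, Matrix.mul_one,
    re_trace_finalState h]

lemma hasDerivAt_prob (hg : 0 ≤ g) (ω : ℝ) (x : Fin s.numOutcomes) :
    HasDerivAt (fun w => s.prob g w t x)
      ((Matrix.of fun i j => deriv (fun w => finalState g w t s.probe i j) ω) * s.povm x).trace.re
      ω := by
  have h : HasDerivAt (fun w => (finalState g w t s.probe * s.povm x).trace)
      ((Matrix.of fun i j => deriv (fun w => finalState g w t s.probe i j) ω) * s.povm x).trace
      ω := by
    simp only [Matrix.trace, Matrix.diag, Matrix.mul_apply]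
    exact HasDerivAt.fun_sum fun i _ => HasDerivAt.fun_sum fun j _ =>
      (hasDerivAt_finalState_deriv hg t ω s.probe i j).mul_const _
  exact Complex.reCLM.hasFDerivAt.comp_hasDerivAt ω h

lemma effProb_dirac {ω T ξ : ℝ} {f : ProbabilityMeasure ℝ}
    (hf : (f : Measure ℝ) = Measure.dirac ξ) (x : Fin s.numOutcomes) :
    s.effProb g ω T f x = s.prob g ω (T * (1 + ξ)) x := by
  rw [effProb, hf, integral_dirac]

lemma mse_nonneg_of_dirac (hg : 0 ≤ g) {ω T ξ : ℝ} {f : ProbabilityMeasure ℝ}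
    (hf : (f : Measure ℝ) = Measure.dirac ξ) : 0 ≤ s.mse g ω T f := by
  refine Finset.sum_nonneg fun x _ => mul_nonneg (Finset.prod_nonneg fun i _ => ?_) (sq_nonneg _)
  rw [s.effProb_dirac hf]
  exact s.prob_nonneg hg _ _

/-- A score of the outcome distribution, with its information bounded by the quantum one. -/
lemma exists_score_of_isSLD (hg : 0 ≤ g) (ω : ℝ)
    {L : Matrix (Fin 2 × Fin s.ancillaDim) (Fin 2 × Fin s.ancillaDim) ℂ}
    (hL : IsSLD (fun w => finalState g w t s.probe) ω L) :
    ∃ l : Fin s.numOutcomes → ℝ,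
      (∀ x, HasDerivAt (fun w => s.prob g w t x) (s.prob g ω t x * l x) ω) ∧
      ∑ x, s.prob g ω t x * l x ^ 2 ≤ (finalState g ω t s.probe * L * L).trace.re := by
  obtain ⟨φ, a, β, φ', a', β', hA, -⟩ := exists_envAmplitudes hg t ω
  have hρ0 := finalState_posSemidef hA ω s.probe
  have hsld : ∀ (x : Fin s.numOutcomes) (c : ℝ),
      0 ≤ (L * finalState g ω t s.probe * L * s.povm x).trace.re
        - 2 * c * ((Matrix.of fun i j => deriv (fun w => finalState g w t s.probe i j) ω)
          * s.povm x).trace.re + c ^ 2 * s.prob g ω t x := by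
    intro x c
    rw [hL.2]
    exact sld_outcome_bound hρ0 (s.povm_posSemidef x) hL.1 c
  obtain ⟨hpl, hsc⟩ := exists_score (s.prob_nonneg hg ω) hsld
  refine ⟨_, fun x => (s.hasDerivAt_prob hg ω x).congr_deriv (hpl x).symm, hsc.trans (le_of_eq ?_)⟩
  rw [← Complex.re_sum, ← Matrix.trace_sum, ← Matrix.mul_sum, s.povm_sum, Matrix.mul_one,
    Matrix.mul_assoc L, Matrix.trace_mul_comm]

/-- The quantum Cramér-Rao inequality for a strategy with linear bias, in terms of any symmetric
logarithmic derivative. -/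
lemma sq_le_mse_mul_of_isSLD (hg : 0 ≤ g) {ω T ξ κ : ℝ} (hω : ω ≠ 0) (hκ : κ ≤ 1)
    {f : ProbabilityMeasure ℝ} (hf : (f : Measure ℝ) = Measure.dirac ξ)
    (hbias : s.BiasLinear κ g ω T f)
    {L : Matrix (Fin 2 × Fin s.ancillaDim) (Fin 2 × Fin s.ancillaDim) ℂ}
    (hL : IsSLD (fun w => finalState g w (T * (1 + ξ)) s.probe) ω L) :
    (1 - κ) ^ 2 ≤ s.mse g ω T f * (1 / ω ^ 2
      + ν * (finalState g ω (T * (1 + ξ)) s.probe * L * L).trace.re) := by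
  obtain ⟨l, hd, hsc⟩ := s.exists_score_of_isSLD hg ω hL
  have hl0 : ∑ x, s.prob g ω (T * (1 + ξ)) x * l x = 0 := by
    have h1 : HasDerivAt (fun w => ∑ x, s.prob g w (T * (1 + ξ)) x)
        (∑ x, s.prob g ω (T * (1 + ξ)) x * l x) ω := HasDerivAt.fun_sum fun x _ => hd x
    simp only [fun w => s.sum_prob (t := T * (1 + ξ)) hg w] at h1
    exact h1.unique (hasDerivAt_const _ _)
  have hb : ∀ w, s.bias g w T f
      = ∑ x, (∏ i, s.prob g w (T * (1 + ξ)) (x i)) * s.estimator x - w := by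
    intro w
    simp only [bias, expect, s.effProb_dirac hf]
  have hbd : HasDerivAt (fun w => s.bias g w T f)
      ((∑ x, (∏ i, s.prob g ω (T * (1 + ξ)) (x i)) * (∑ i, l (x i)) * s.estimator x) - 1) ω := by
    simp only [hb]
    exact (hasDerivAt_sum_prod_mul (p := fun w => s.prob g w (T * (1 + ξ))) hd s.estimator).sub
      (hasDerivAt_id ω)
  have hmse : s.mse g ω T f
      = ∑ x, (∏ i, s.prob g ω (T * (1 + ξ)) (x i)) * (s.estimator x - ω) ^ 2 := by
    simp only [mse, expect, s.effProb_dirac hf]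
  have h0 := s.mse_nonneg_of_dirac (ω := ω) (T := T) hg hf
  rw [BiasLinear, hbd.deriv] at hbias
  have key := sq_le_mse_mul hω hκ (s.prob_nonneg hg ω) (s.sum_prob hg ω) hl0 s.estimator (hb ω) rfl
    hbias
  rw [← hmse] at key
  refine key.trans (mul_le_mul_of_nonneg_left ?_ h0)
  gcongr

end FEStrategy

/-- The biased Cramér-Rao bound on the loss for one value of the time imperfection. -/
lemma div_le_lossFE {g ω T ε κ ξ : ℝ} {ν : ℕ} {𝒩 : Set (ProbabilityMeasure ℝ)} (hg : 0 ≤ g)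
    (hω : ω ≠ 0) (hκ : κ ≤ 1) (hν : 1 ≤ ν)
    (h𝒩 : 𝒩 = deltaTDI ε ∨ 𝒩 = boundedTDI ε) (hξ : ξ ∈ Set.Icc (-ε) ε) :
    ENNReal.ofReal ((1 - κ) ^ 2) /
        (ENNReal.ofReal (1 / ω ^ 2) + (ν : ℝ≥0∞) * qfiFE g ω (T * (1 + ξ)))
      ≤ lossFE κ 𝒩 ν g ω T := by
  refine le_iInf₂ fun s hs => ?_
  -- The delta distribution at ξ lies in either admissible set, so both cases are treated at once.
  let f : ProbabilityMeasure ℝ := ⟨Measure.dirac ξ, inferInstance⟩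
  have hf : (f : Measure ℝ) = Measure.dirac ξ := rfl
  have hmem : f ∈ 𝒩 := by
    rcases h𝒩 with rfl | rfl
    · exact ⟨ξ, hξ, hf⟩
    · simp only [boundedTDI, Set.mem_ofPred_eq, hf]
      rw [Measure.dirac_apply' _ measurableSet_Icc.compl]
      simp [hξ.1, hξ.2]
  refine le_trans ?_ (le_iSup₂ (f := fun f (_ : f ∈ 𝒩) => ENNReal.ofReal (s.mse g ω T f)) f hmem)
  have hm0 := s.mse_nonneg_of_dirac (ω := ω) (T := T) hg hf
  have hkey := fun L hL => s.sq_le_mse_mul_of_isSLD (L := L) hg hω hκ hf (hs f hmem) hL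
  set m := s.mse g ω T f with hm
  have hω2 : 0 < 1 / ω ^ 2 := by positivity
  have hν0 : (0 : ℝ) < ν := by exact_mod_cast hν
  have hq : qfi (fun w => finalState g w (T * (1 + ξ)) s.probe) ω ≤ qfiFE g ω (T * (1 + ξ)) :=
    le_iSup₂ (f := fun d (ρ : DensityMatrix (Fin 2 × Fin d)) =>
      qfi (fun w => finalState g w (T * (1 + ξ)) ρ) ω) s.ancillaDim s.probe
  refine le_trans (ENNReal.div_le_div_left (add_le_add_right (mul_le_mul_right hq _) _) _) ?_
  rcases le_or_gt ((1 - κ) ^ 2) 0 with hk | hk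
  · simp [ENNReal.ofReal_of_nonpos hk]
  rcases hm0.eq_or_lt with hm1 | hm1
  · have : qfi (fun w => finalState g w (T * (1 + ξ)) s.probe) ω = ⊤ := by
      rw [qfi, iInf₂_eq_top]
      intro L hL
      have := hkey L hL
      rw [← hm1, zero_mul] at this
      linarith
    rw [this, ENNReal.mul_top (by exact_mod_cast hν0.ne')]
    simp
  -- The inequality solved for Tr(ρL²) holds for every `L`, hence for the infimum. Truncating a
  -- negative value to 0 only helps, as `ofReal` is subadditive.
  · have hy : ENNReal.ofReal (((1 - κ) ^ 2 / m - 1 / ω ^ 2) / ν)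
        ≤ qfi (fun w => finalState g w (T * (1 + ξ)) s.probe) ω := by
      refine le_iInf₂ fun L hL => ENNReal.ofReal_le_ofReal ?_
      have := hkey L hL
      rw [div_le_iff₀ hν0, sub_le_iff_le_add, div_le_iff₀ hm1]
      linarith
    refine ENNReal.div_le_of_le_mul ?_
    refine le_trans ?_ (mul_le_mul_right (add_le_add_right (mul_le_mul_right hy _) _) _)
    rw [← ENNReal.ofReal_natCast ν, ← ENNReal.ofReal_mul hν0.le,
      mul_div_cancel₀ _ hν0.ne']
    have e : (1 - κ) ^ 2 = m * (1 / ω ^ 2 + ((1 - κ) ^ 2 / m - 1 / ω ^ 2)) := by field_simp; ring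
    calc ENNReal.ofReal ((1 - κ) ^ 2)
        = ENNReal.ofReal m
          * ENNReal.ofReal (1 / ω ^ 2 + ((1 - κ) ^ 2 / m - 1 / ω ^ 2)) := by
          rw [← ENNReal.ofReal_mul hm0, ← e]
      _ ≤ _ := mul_le_mul_right ENNReal.ofReal_add_le _

/-! ### The uncoupled case g = 0 -/

/-- A lower bound on the quantum information from the observable `X`. -/
lemma two_mul_re_trace_le {n : Type} [Fintype n] [DecidableEq n] {ρ L X : Matrix n n ℂ}
    (hρ : ρ.PosSemidef) (hL : L.IsHermitian) (hX : X.IsHermitian) :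
    2 * (((1 / 2 : ℂ) • (ρ * L + L * ρ)) * X).trace.re
      ≤ (ρ * L * L).trace.re + (ρ * (X * X)).trace.re := by
  have h := (hρ.mul_mul_conjTranspose_same (L - X)).trace_nonneg
  have h0 := (Complex.nonneg_iff.mp h).1
  rw [Matrix.conjTranspose_sub, hL.eq, hX.eq] at h0
  have e1 : (L * ρ * L).trace = (ρ * L * L).trace := by
    rw [Matrix.mul_assoc, Matrix.trace_mul_comm]
  have e2 : (X * ρ * L).trace = (ρ * L * X).trace := by
    rw [Matrix.mul_assoc, Matrix.trace_mul_comm]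
  have e3 : (X * ρ * X).trace = (ρ * (X * X)).trace := by
    rw [Matrix.mul_assoc, Matrix.trace_mul_comm, Matrix.mul_assoc]
  have e4 : (((1 / 2 : ℂ) • (ρ * L + L * ρ)) * X).trace.re
      = 1 / 2 * ((ρ * L * X).trace.re + (L * ρ * X).trace.re) := by
    rw [Matrix.smul_mul, Matrix.trace_smul, Matrix.add_mul, Matrix.trace_add, smul_eq_mul,
      show (1 / 2 : ℂ) = ((1 / 2 : ℝ) : ℂ) by norm_num, Complex.re_ofReal_mul, Complex.add_re]
  simp only [Matrix.sub_mul, Matrix.mul_sub, Matrix.trace_sub, Complex.sub_re, e1, e2, e3] at h0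
  rw [e4]
  linarith

lemma qfiFE_zero_le (ω T : ℝ) : qfiFE 0 ω T ≤ ENNReal.ofReal (T ^ 2) := by
  rw [show T ^ 2 = 4 * (T / 2) ^ 2 by ring]
  have ha : ‖Complex.exp (-(Complex.I * T * (1 - ω / 2)))‖ = 1 := by
    rw [show Complex.I * T * (1 - ω / 2) = Complex.I * ((T * (1 - ω / 2) : ℝ) : ℂ) by
      push_cast; ring, norm_exp_neg_I_mul]
  have hn : ‖(Complex.I * T / 2 : ℂ)‖ ^ 2 = (T / 2) ^ 2 := by
    simp [div_pow]
  refine qfiFE_le (envAmplitudes_zero T) (hasDerivAt_phaseAmp 0 T ω) (hasDerivAt_stayAmp_zero T ω)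
    (hasDerivAt_const _ _) 0 ?_ ?_
  · rw [Complex.ofReal_zero, mul_zero, zero_mul, add_zero, norm_mul, norm_neg, norm_phaseAmp,
      mul_one, hn]
  · rw [Complex.ofReal_zero, mul_zero, zero_mul, add_zero, norm_mul, ha, mul_one, hn]
    simp

/-- A square root factor of the probe `|+⟩⟨+|`, with a trivial ancilla. -/
noncomputable def plusFactor : Matrix (Fin 2 × Fin 1) (Fin 1) ℂ :=
  Matrix.of fun _ _ => ((1 / Real.sqrt 2 : ℝ) : ℂ)

/-- The probe `|+⟩⟨+|`, with a trivial ancilla. -/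
noncomputable def plusProbe : DensityMatrix (Fin 2 × Fin 1) where
  mat := plusFactor * plusFactorᴴ
  posSemidef := Matrix.posSemidef_self_mul_conjTranspose _
  trace_eq_one := by
    have h : ((1 / Real.sqrt 2 : ℝ) : ℂ) * ((1 / Real.sqrt 2 : ℝ) : ℂ) = 1 / 2 := by
      rw [← Complex.ofReal_mul, div_mul_div_comm, Real.mul_self_sqrt zero_le_two]
      norm_num
    simp only [Matrix.trace, Matrix.diag, Matrix.mul_apply, plusFactor, Matrix.conjTranspose_apply,
      Matrix.of_apply, Complex.star_def, Complex.conj_ofReal, h]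
    simp

lemma le_qfiFE_zero (ω T : ℝ) : ENNReal.ofReal (T ^ 2) ≤ qfiFE 0 ω T := by
  refine le_trans ?_ (le_iSup₂ (f := fun d (ρ : DensityMatrix (Fin 2 × Fin d)) =>
    qfi (fun w => finalState 0 w T ρ) ω) 1 plusProbe)
  refine le_iInf₂ fun L hL => ENNReal.ofReal_le_ofReal ?_
  have hZ : plusProbe.mat = plusFactor * plusFactorᴴ := rfl
  have hA := envAmplitudes_zero T
  have hρ := finalState_posSemidef hA ω plusProbe
  have htr := re_trace_finalState hA ω plusProbe
  set a : ℂ := Complex.exp (-(Complex.I * T * (1 - ω / 2))) with ha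
  set φ : ℂ := phaseAmp 0 T ω with hφ
  have hφ1 : φ * (starRingEnd ℂ) φ = 1 := by
    rw [Complex.mul_conj, Complex.normSq_eq_norm_sq, norm_phaseAmp]; norm_num
  have ha1 : a * (starRingEnd ℂ) a = 1 := by
    rw [Complex.mul_conj, Complex.normSq_eq_norm_sq, ha,
      show Complex.I * T * (1 - ω / 2) = Complex.I * ((T * (1 - ω / 2) : ℝ) : ℂ) by
      push_cast; ring, norm_exp_neg_I_mul]
    norm_num
  have hder : (Matrix.of fun i j => deriv (fun w => finalState 0 w T plusProbe i j) ω)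
      = krausFactor (ampKraus (-(Complex.I * T / 2) * φ) (Complex.I * T / 2 * a) 0) plusFactor
          * (krausFactor (ampKraus φ a 0) plusFactor)ᴴ
        + krausFactor (ampKraus φ a 0) plusFactor
          * (krausFactor (ampKraus (-(Complex.I * T / 2) * φ) (Complex.I * T / 2 * a) 0)
            plusFactor)ᴴ := by
    ext i j
    exact (hasDerivAt_finalState hA (hasDerivAt_phaseAmp 0 T ω) (hasDerivAt_stayAmp_zero T ω)
      (hasDerivAt_const _ _) hZ i j).deriv
  have e : φ * (starRingEnd ℂ) φ * (a * (starRingEnd ℂ) a) = 1 := by rw [hφ1, ha1, one_mul]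
  -- `X` is twice the derivative of the pure final state, which is its logarithmic derivative. With
  -- X² = T² and Tr(ρ'X) = T² the observable bound gives 2T² ≤ Tr(ρL²) + T².
  let X : Matrix (Fin 2 × Fin 1) (Fin 2 × Fin 1) ℂ := Matrix.of fun p q =>
    T * (!![0, -Complex.I * φ * (starRingEnd ℂ) a; Complex.I * (starRingEnd ℂ) φ * a, 0] p.1 q.1)
  have hX : X.IsHermitian := by
    ext ⟨s, i⟩ ⟨s', i'⟩
    fin_cases s <;> fin_cases s' <;> simp [X]
  have hXX : X * X = ((T ^ 2 : ℝ) : ℂ) • (1 : Matrix (Fin 2 × Fin 1) (Fin 2 × Fin 1) ℂ) := by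
    ext ⟨s, i⟩ ⟨s', i'⟩
    fin_cases i; fin_cases i'
    fin_cases s <;> fin_cases s' <;>
      simp [X, Matrix.mul_apply, Fintype.sum_prod_type, Fin.sum_univ_two]
    all_goals linear_combination (T : ℂ) ^ 2 * e
      - (T : ℂ) ^ 2 * φ * (starRingEnd ℂ) φ * (a * (starRingEnd ℂ) a) * Complex.I_sq
  have key := two_mul_re_trace_le hρ hL.1 hX
  have e1 : (finalState 0 ω T plusProbe * (X * X)).trace.re = T ^ 2 := by
    rw [hXX, Matrix.mul_smul, Matrix.mul_one, Matrix.trace_smul, smul_eq_mul,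
      Complex.re_ofReal_mul, htr, mul_one]
  have e2 : (((1 / 2 : ℂ) • (finalState 0 ω T plusProbe * L + L * finalState 0 ω T plusProbe))
      * X).trace = ((T ^ 2 : ℝ) : ℂ) := by
    have hz : ((1 / Real.sqrt 2 : ℝ) : ℂ) * (starRingEnd ℂ) ((1 / Real.sqrt 2 : ℝ) : ℂ)
        = 1 / 2 := by
      rw [Complex.conj_ofReal, ← Complex.ofReal_mul, div_mul_div_comm,
        Real.mul_self_sqrt zero_le_two]
      norm_num
    rw [← hL.2, hder]
    simp only [Matrix.trace, Matrix.diag, Matrix.mul_apply, Matrix.add_apply,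
      Matrix.conjTranspose_apply, Fintype.sum_prod_type, Fin.sum_univ_two, krausFactor, ampKraus,
      plusFactor, X, Matrix.of_apply, Finset.univ_unique, Finset.sum_singleton]
    generalize ((1 / Real.sqrt 2 : ℝ) : ℂ) = z at *
    simp
    linear_combination
      -(2 * (T : ℂ) ^ 2 * φ * (starRingEnd ℂ) φ * a * (starRingEnd ℂ) a * z * (starRingEnd ℂ) z)
        * Complex.I_sq + 2 * (T : ℂ) ^ 2 * z * (starRingEnd ℂ) z * e
        + 2 * (T : ℂ) ^ 2 * hz
  rw [e2, Complex.ofReal_re, e1] at key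
  linarith

lemma qfiFE_zero (ω T : ℝ) : qfiFE 0 ω T = ENNReal.ofReal (T ^ 2) :=
  le_antisymm (qfiFE_zero_le ω T) (le_qfiFE_zero ω T)

/-! ### Loss bounds for a phase window -/

lemma ofReal_div_le_lossFE {g ω T ε κ ξ X : ℝ} {ν : ℕ} {𝒩 : Set (ProbabilityMeasure ℝ)}
    (hg : 0 ≤ g) (hω : ω ≠ 0) (hκ : κ ≤ 1) (hν : 1 ≤ ν)
    (h𝒩 : 𝒩 = deltaTDI ε ∨ 𝒩 = boundedTDI ε) (hξ : ξ ∈ Set.Icc (-ε) ε) (hX : 0 ≤ X)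
    (hq : qfiFE g ω (T * (1 + ξ)) ≤ ENNReal.ofReal X) :
    ENNReal.ofReal ((1 - κ) ^ 2 / (1 / ω ^ 2 + ν * X)) ≤ lossFE κ 𝒩 ν g ω T := by
  refine le_trans ?_ (div_le_lossFE hg hω hκ hν h𝒩 hξ)
  have hω2 : 0 < 1 / ω ^ 2 := by positivity
  rw [ENNReal.ofReal_div_of_pos (by positivity)]
  refine ENNReal.div_le_div_left ?_ _
  rw [ENNReal.ofReal_add hω2.le (by positivity), ENNReal.ofReal_mul (by positivity),
    ENNReal.ofReal_natCast]
  exact add_le_add_right (mul_le_mul_right hq _) _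

/-- Moves the relative error of the duration out of the denominator: (1+2δ)² ≤ 1 + 8δ for 0 ≤ δ ≤ 1,
and (1-8δ)(1+8δ) ≤ 1. -/
lemma inv_add_lower_bound {a b δ : ℝ} (ha : 0 < a) (hb : 0 ≤ b) (hδ : 0 ≤ δ) (hδ1 : δ ≤ 1) :
    (1 - 8 * δ) * (1 / (a + b)) ≤ 1 / (a + (1 + 2 * δ) ^ 2 * b) := by
  have h : a + (1 + 2 * δ) ^ 2 * b ≤ (1 + 8 * δ) * (a + b) := by
    nlinarith [mul_nonneg hδ ha.le, mul_nonneg (mul_nonneg hδ (sub_nonneg.mpr hδ1)) hb]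
  calc (1 - 8 * δ) * (1 / (a + b)) ≤ 1 / ((1 + 8 * δ) * (a + b)) := by
        rw [mul_one_div, div_le_div_iff₀ (by positivity) (by positivity)]
        nlinarith [sq_nonneg δ, mul_nonneg (sq_nonneg δ) (add_pos_of_pos_of_nonneg ha hb).le]
    _ ≤ _ := one_div_le_one_div_of_le (by positivity) h

/-- The lower bound on the loss when the time imperfection covers the phase range `ψ`. -/
lemma phase_range_bound_le_lossFE {g ω T ε κ ψ E : ℝ} {ν : ℕ}
    {𝒩 : Set (ProbabilityMeasure ℝ)}
    (hg : 0 < g) (hω : ω ≠ 0) (hgT : 1 ≤ g * T) (hκ : κ ≤ 1) (hν : 1 ≤ ν)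
    (h𝒩 : 𝒩 = deltaTDI ε ∨ 𝒩 = boundedTDI ε) (hψ : 0 ≤ ψ) (hψ' : ψ ≤ Real.pi / 2)
    (hψε : ψ / (rabi g ω * T) ≤ ε) (hE : 0 ≤ E) :
    ENNReal.ofReal ((1 - κ) ^ 2 * ((1 - 33 / (g * T))
        * (1 / (1 / ω ^ 2 + ν * T ^ 2 * (ω ^ 2 / g ^ 2 + Real.cos ψ ^ 2))) - E))
      ≤ lossFE κ 𝒩 ν g ω T := by
  have hgT0 : 0 < g * T := by linarith
  have hT : 0 < T := (pos_iff_pos_of_mul_pos hgT0).mp hg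
  have hω2 : 0 < 1 / ω ^ 2 := by positivity
  set Q := ω ^ 2 / g ^ 2 + Real.cos ψ ^ 2 with hQ
  have hQ0 : 0 ≤ Q := by positivity
  have hmain0 : 0 ≤ 1 / (1 / ω ^ 2 + ν * T ^ 2 * Q) := by positivity
  -- For gT < 33 the prefactor 1 - 33/(gT) is negative and the claim is trivial. In the other case 8
  -- would do; 33 is kept to share one constant with the QFI bound.
  rcases le_or_gt 33 (g * T) with h33 | h33
  · obtain ⟨ξ, hξ, hq⟩ := exists_qfiFE_le (ω := ω) hg hT (by linarith) hψ hψ'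
    refine le_trans (ENNReal.ofReal_le_ofReal ?_) (ofReal_div_le_lossFE hg.le hω hκ hν h𝒩
      (abs_le.mp (hξ.trans hψε)) (by positivity) hq)
    have h1 := inv_add_lower_bound (δ := 1 / (g * T)) hω2
      (show 0 ≤ ν * T ^ 2 * Q by positivity) (by positivity)
      (by rw [div_le_one hgT0]; exact hgT)
    refine le_trans (mul_le_mul_of_nonneg_left ?_ (sq_nonneg _)) (le_of_eq (mul_one_div _ _))
    have e : 1 / ω ^ 2 + ν * (T ^ 2 * (1 + 2 / (g * T)) ^ 2 * Q)
        = 1 / ω ^ 2 + (1 + 2 * (1 / (g * T))) ^ 2 * (ν * T ^ 2 * Q) := by ring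
    rw [e]
    refine le_trans ?_ h1
    have h2 : (1 - 33 / (g * T)) ≤ 1 - 8 * (1 / (g * T)) := by
      rw [mul_one_div]; gcongr; norm_num
    linarith [mul_le_mul_of_nonneg_right h2 hmain0]
  · have h1 : 1 - 33 / (g * T) ≤ 0 := by
      rw [sub_nonpos, one_le_div hgT0]; exact h33.le
    have h2 : (1 - 33 / (g * T)) * (1 / (1 / ω ^ 2 + ν * T ^ 2 * Q)) - E ≤ 0 := by
      linarith [mul_nonpos_of_nonpos_of_nonneg h1 hmain0]
    rw [ENNReal.ofReal_of_nonpos (mul_nonpos_of_nonneg_of_nonpos (sq_nonneg _) h2)]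
    exact zero_le

/-- The bound for large ε is the phase-window bound saturated at ψ = π/2. -/
lemma boundLarge_eq {g ω : ℝ} (hg : 0 < g) (hω : ω ≠ 0) (ν : ℕ) (T : ℝ) :
    boundLarge ν g ω T = 1 / (1 / ω ^ 2 + ν * T ^ 2 * (ω ^ 2 / g ^ 2 + Real.cos (Real.pi / 2) ^ 2))
      := by
  rw [boundLarge, Real.cos_pi_div_two]
  have : 0 < (ν : ℝ) * ω ^ 4 * T ^ 2 + g ^ 2 := by positivity
  have h2 : 0 < 1 / ω ^ 2 + (ν : ℝ) * T ^ 2 * (ω ^ 2 / g ^ 2 + 0 ^ 2) := by positivity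
  rw [div_eq_div_iff this.ne' h2.ne']
  field_simp
  ring

/-- The ratio depends on ν and T only through y = νT², which tends to infinity. -/
lemma tendsto_boundLarge_div_heisenbergLimit {g ω : ℝ} (hω : ω ≠ 0) :
    Tendsto (fun p : ℕ × ℝ => boundLarge p.1 g ω p.2 / heisenbergLimit p.1 p.2)
      (atTop ×ˢ atTop) (𝓝 (g ^ 2 / ω ^ 2)) := by
  have hy : Tendsto (fun p : ℕ × ℝ => (p.1 : ℝ) * p.2 ^ 2) (atTop ×ˢ atTop) atTop :=
    (tendsto_natCast_atTop_atTop.comp tendsto_fst).atTop_mul_atTop₀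
      ((tendsto_pow_atTop two_ne_zero).comp tendsto_snd)
  have hlim : Tendsto (fun y : ℝ => g ^ 2 * ω ^ 2 / (ω ^ 4 + g ^ 2 * y⁻¹)) atTop
      (𝓝 (g ^ 2 * ω ^ 2 / (ω ^ 4 + g ^ 2 * 0))) :=
    tendsto_const_nhds.div (tendsto_const_nhds.add (tendsto_inv_atTop_zero.const_mul _))
      (by simpa using hω)
  have e : g ^ 2 * ω ^ 2 / (ω ^ 4 + g ^ 2 * 0) = g ^ 2 / ω ^ 2 := by
    field_simp; ring
  rw [e] at hlim
  refine (hlim.comp hy).congr' ?_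
  filter_upwards [hy.eventually_gt_atTop 0] with p hp
  simp only [Function.comp_apply, boundLarge, heisenbergLimit]
  have h1 : (p.1 : ℝ) * ω ^ 4 * p.2 ^ 2 + g ^ 2 = ω ^ 4 * (p.1 * p.2 ^ 2) + g ^ 2 := by ring
  rw [h1]
  generalize (p.1 : ℝ) * p.2 ^ 2 = y at *
  have h2 : ω ^ 4 + g ^ 2 * y⁻¹ = (ω ^ 4 * y + g ^ 2) / y := by field_simp
  rw [h2, div_div_eq_mul_div, div_div_eq_mul_div, div_one, mul_div_right_comm,
    mul_div_right_comm]

end TDI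

theorem mainTheorem2 :
    -- without the environment the maximal QFI is `T²`, so the Heisenberg limit is `1/(νT²)`
    (∀ ω T : ℝ, 0 < T → TDI.qfiFE 0 ω T = ENNReal.ofReal (T ^ 2)) ∧
    -- bias-optimized biased Cramér-Rao bound
    (∀ (g ω T ε κ : ℝ) (ν : ℕ) (𝒩 : Set (ProbabilityMeasure ℝ)),
      0 ≤ g → ω ≠ 0 → 0 < T → 0 ≤ ε → 0 ≤ κ → κ ≤ 1 → 1 ≤ ν →
      (𝒩 = TDI.deltaTDI ε ∨ 𝒩 = TDI.boundedTDI ε) →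
      (⨆ ξ ∈ Set.Icc (-ε) ε,
          ENNReal.ofReal ((1 - κ) ^ 2) /
            (ENNReal.ofReal (1 / ω ^ 2) + (ν : ℝ≥0∞) * TDI.qfiFE g ω (T * (1 + ξ))))
        ≤ TDI.lossFE κ 𝒩 ν g ω T) ∧
    -- the bounds in the strong-coupling regime, with one absolute constant `C`
    (∃ C : ℝ, 0 < C ∧
      (∀ g ω T ξ : ℝ, 0 < g → |ω| ≤ g → 0 < T →
        TDI.qfiFE g ω (T * (1 + ξ)) ≤ ENNReal.ofReal
          (2 * (g * (T * (1 + ξ)) * Real.cos (TDI.rabi g ω * (T * (1 + ξ)))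
                + Real.sin (TDI.rabi g ω * (T * (1 + ξ)))) ^ 2
              / (g ^ 2 * (Real.cos (2 * (T * (1 + ξ)) * TDI.rabi g ω) + 3))
            + C * (ω ^ 2 * (T * (1 + ξ)) ^ 2 / g ^ 2))) ∧
      (∀ g ω T ξ : ℝ, 0 < g → |ω| ≤ g → 0 < T → g ≤ ω ^ 2 * T → |ξ| ≤ 1 →
        TDI.qfiFE g ω (T * (1 + ξ)) ≤ ENNReal.ofReal
          (2 * T ^ 2 * (1 + ξ) ^ 2 * Real.cos (T * TDI.rabi g ω * (1 + ξ)) ^ 2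
              / (Real.cos (2 * T * (1 + ξ) * TDI.rabi g ω) + 3)
            + C * (ω ^ 2 * T ^ 2 / g ^ 2))) ∧
      (∀ (g ω T ε κ : ℝ) (ν : ℕ) (𝒩 : Set (ProbabilityMeasure ℝ)),
        0 < g → ω ≠ 0 → |ω| ≤ g → 1 ≤ g * T → 0 ≤ ε → 0 ≤ κ → κ ≤ 1 → 1 ≤ ν →
        (𝒩 = TDI.deltaTDI ε ∨ 𝒩 = TDI.boundedTDI ε) →
        (TDI.epsStar g ω T ≤ ε →
          ENNReal.ofReal ((1 - κ) ^ 2 *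
            ((1 - C / (g * T)) * TDI.boundLarge ν g ω T
              - C * (ν * ω ^ 8 * T ^ 2 / (g ^ 2 + ν * T ^ 2 * ω ^ 4) ^ 2)))
            ≤ TDI.lossFE κ 𝒩 ν g ω T) ∧
        (ε < TDI.epsStar g ω T →
          ENNReal.ofReal ((1 - κ) ^ 2 *
            ((1 - C / (g * T)) * TDI.boundSmall ν g ω T ε
              - C * (ω ^ 4 / (ν * T ^ 2 *
                  (g ^ 2 * Real.cos (T * TDI.rabi g ω * ε) ^ 2 + ω ^ 2) ^ 2))))
            ≤ TDI.lossFE κ 𝒩 ν g ω T))) ∧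
    -- for large `ν` and `T` the bound is a factor `g²/ω²` above the Heisenberg limit
    (∀ g ω : ℝ, 0 < g → ω ≠ 0 →
      Tendsto (fun p : ℕ × ℝ => TDI.boundLarge p.1 g ω p.2 / TDI.heisenbergLimit p.1 p.2)
        (atTop ×ˢ atTop) (𝓝 (g ^ 2 / ω ^ 2))) := by
  refine ⟨fun ω T _ => TDI.qfiFE_zero ω T, ?_, ⟨33, by norm_num, ?_, ?_, ?_⟩, ?_⟩
  · intro g ω T ε κ ν 𝒩 hg hω _ _ _ hκ hν h𝒩
    exact iSup₂_le fun ξ hξ => TDI.div_le_lossFE hg hω hκ hν h𝒩 hξ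
  · intro g ω T ξ hg hω _
    refine (TDI.qfiFE_le_strong hg hω _).trans (ENNReal.ofReal_le_ofReal ?_)
    gcongr
    norm_num
  · intro g ω T ξ hg hω hT hgT hξ
    exact TDI.qfiFE_le_strong_long hg hω hT hgT hξ
  · intro g ω T ε κ ν 𝒩 hg hω hωg hgT hε _ hκ hν h𝒩
    have hT : 0 < T := (pos_iff_pos_of_mul_pos (by linarith : 0 < g * T)).mp hg
    have hΩ := TDI.rabi_pos hg ω
    have hpi := Real.pi_pos
    refine ⟨fun hε' => ?_, fun hε' => ?_⟩
    -- Window ψ = π/2, whose relative width π/(2ΩT) is exactly ε*. The subtracted correction is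
    -- nonnegative and plays the role of `E`.
    · rw [TDI.boundLarge_eq hg hω]
      refine TDI.phase_range_bound_le_lossFE hg hω hgT hκ hν h𝒩 (by positivity) le_rfl ?_
        (by positivity)
      refine le_trans (le_of_eq ?_) hε'
      rw [TDI.epsStar, div_div, mul_assoc]
    · have hb : TDI.boundSmall ν g ω T ε = 1 / (1 / ω ^ 2
          + ν * T ^ 2 * (ω ^ 2 / g ^ 2 + Real.cos (ε * T * TDI.rabi g ω) ^ 2)) := by
        rw [TDI.boundSmall, add_comm]
      rw [hb]
      -- Window ψ = εTΩ, the whole phase range of the imperfection; ε < ε* says that it is below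
      -- π/2.
      refine TDI.phase_range_bound_le_lossFE hg hω hgT hκ hν h𝒩 (by positivity) ?_ ?_
        (by positivity)
      · rw [TDI.epsStar, lt_div_iff₀ (by positivity)] at hε'
        linarith
      · refine le_of_eq ?_
        field_simp
  · exact fun g ω _ hω => TDI.tendsto_boundLarge_div_heisenbergLimit hω
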